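/- Let $(\Omega,\mathcal A,\mu)$ be an arbitrary measure space and $M$ a complete metric space. An *atom* is a set $A\in\mathcal A$ with $\mu(A)>0$ such that every measurable $B\subset A$ has $\mu(B)\in\{0,\mu(A)\}$ (for $\mu(A)=\infty$: $\mu(B)\in\{0,\infty\}$). Let $\mathcal A_{a\sigma}$ be the system of all unions of countably many atoms and one measurable $\sigma$-finite set, and let $\mathcal S(M)$ be the separable subsets of $M$. A property holds *integrally a.e.* (i.a.e.) if its exceptional set meets every atom and every $\sigma$-finite set in a null set; if the exceptional set is measurable for the completion of $\mu$, this is the same as a.e. A function $u\colon\Omega\to M$ is *integrally strongly measurable* if it is strongly measurable on every atom and every $\sigma$-finite set. An integrand $f\colon\Omega\times M\to[-\infty,\infty]$ is *integrally separably measurable* if for every $W\in\mathcal S(M)$ and every $A$ that is an atom or a $\sigma$-finite set, $f|_{A\times W}$ is measurable for the product of the trace $\sigma$-algebra of $\mathcal A$ on $A$ and the Borel $\sigma$-algebra of $W$. The *exhausting integral* of a family $\alpha_A\colon A\to[-\infty,\infty]$, $A\in\mathcal A_{a\sigma}$, with $\alpha_A=\alpha_B$ a.e. on $A\cap B$, is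 $\int\alpha=P-N$ with $P=\sup_{A\in\mathcal A_{a\sigma}}\int_A\alpha_A^+\,d\bar\mu$ and $N=\sup_{A\in\mathcal A_{a\sigma}}\int_A\alpha_A^-\,d\bar\mu$, where $\infty-\infty=\infty$; a single function $\alpha$ is regarded as the family of its restrictions. Put $I_f(u)=\int f[\omega,u(\omega)]\,d\mu(\omega)$ in this sense. A set $R$ of functions $\Omega\to M$ is *almost decomposable* if for all $u_0\in R$, all $F\in\mathcal A$ with $\mu(F)<\infty$, all $\varepsilon>0$ and all bounded strongly measurable $u_1\colon F\to M$ there is a measurable $F_\varepsilon\subset F$ with $\mu(F\setminus F_\varepsilon)<\varepsilon$ such that the function equal to $u_1$ on $F_\varepsilon$ and to $u_0$ on $\Omega\setminus F_\varepsilon$ belongs to $R$. The *essential infimum function* on $A\in\mathcal A_{a\sigma}$ of a family of functions $v_i$ is a function $m$ on $A$, measurable for the completion, with $m\le v_i$ a.e. on $A$ for every $i$, and such that every other such function $n$ satisfies $n\le m$ a.e. on $A$. The essential infimum function on $\Omega$ is defined in the same way, with $m\le v_i$ and $n\le v_i$ required i.a.e. on $\Omega$. **Theorem.** Let $R$ be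 an almost decomposable set of integrally strongly measurable functions $\Omega\to M$ and $f\colon\Omega\times M\to[-\infty,\infty]$ an integrally separably measurable integrand. Suppose that for every atom $A$ with $\mu(A)=\infty$ and every $W\in\mathcal S(M)$ there holds $\inf_{x\in W}f(\omega,x)\ge0$ for a.e. $\omega\in A$. If $I_f\not\equiv\infty$ on $R$, then the essential infimum function $m_A$ of the family $\inf_{x\in W}f(\cdot,x)$, $W\in\mathcal S(M)$, exists on every $A\in\mathcal A_{a\sigma}$, and $$\inf_{u\in R}I_f(u)=\int\operatorname*{ess\,inf}_{W\in\mathcal S(M)}\ \inf_{x\in W}f(\omega,x)\,d\bar\mu(\omega),$$ the right-hand side being the exhausting integral of the family $(m_A)$. Moreover, if this common value is not $-\infty$, then the essential infimum function $\bar m$ of the family exists on all of $\Omega$, and the common value equals $\int\bar m\,d\bar\mu$. For every $A\in\mathcal A_{a\sigma}$ there is $W\in\mathcal S(M)$ with $\bar m=\inf_{x\in W}f(\cdot,x)$ a.e. on $A$. If some $u\in R$ with $I_f(u)<\infty$ takes its values i.a.e. in a separable set (for instance, if the elements of $R$ are strongly measurable on $\Omega$), then there is a single $W\in\mathcal S(M)$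 with $\bar m=\inf_{x\in W}f(\cdot,x)$ i.a.e. on $\Omega$. Finally, for $\bar u\in R$, $$\bar u\in\operatorname*{Arg\,min}_{u\in R}I_f(u)\iff f[\omega,\bar u(\omega)]=\bar m(\omega)\ \text{ i.a.e.},$$ and here "i.a.e." may be replaced by "$\mu$-a.e." whenever $\omega\mapsto f[\omega,\bar u(\omega)]$ is measurable for the completion of $\mu$. -/

import Mathlib

open MeasureTheory Set TopologicalSpace
open scoped ENNReal

noncomputable section

namespace InfInt

variable {Ω M : Type*} [MeasurableSpace Ω]

/-- An atom: a measurable set of positive measure each of whose measurable subsets has either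
measure zero or full measure. For `μ A = ∞` this says that every measurable subset has measure
`0` or `∞`; thus a measure without atoms has the finite subset property. -/
def IsMeasureAtom (μ : Measure Ω) (A : Set Ω) : Prop :=
  MeasurableSet A ∧ μ A ≠ 0 ∧ ∀ B ⊆ A, MeasurableSet B → μ B = 0 ∨ μ B = μ A

/-- A measurable set of `σ`-finite measure. -/
def IsSigmaFiniteSet (μ : Measure Ω) (A : Set Ω) : Prop :=
  MeasurableSet A ∧ SigmaFinite (μ.restrict A)

/-- The sets on which an "integral" property is tested: atoms and `σ`-finite sets. -/
def IsTestSet (μ : Measure Ω) (A : Set Ω) : Prop :=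
  IsMeasureAtom μ A ∨ IsSigmaFiniteSet μ A

/-- The `σ`-ring of all unions of countably many atoms and a `σ`-finite set. -/
def atomSigmaRing (μ : Measure Ω) : Set (Set Ω) :=
  {A | ∃ C : Set (Set Ω), C.Countable ∧ (∀ S ∈ C, IsMeasureAtom μ S) ∧
    ∃ B, IsSigmaFiniteSet μ B ∧ A = ⋃₀ C ∪ B}

/-- A property holds integrally almost everywhere if its exceptional set meets every atom and
every `σ`-finite set in a null set. -/
def IntAE (μ : Measure Ω) (p : Ω → Prop) : Prop :=
  ∀ A, IsTestSet μ A → μ ({ω | ¬ p ω} ∩ A) = 0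

/-- If the exceptional set is measurable with respect to the completion, then "integrally almost
everywhere" is the same as "almost everywhere". -/
theorem intAE_iff_ae {μ : Measure Ω} {p : Ω → Prop} (hp : NullMeasurableSet {ω | ¬ p ω} μ) :
    IntAE μ p ↔ ∀ᵐ ω ∂μ, p ω := by
  rw [ae_iff]
  refine ⟨fun h => ?_, fun h A _ => measure_mono_null inter_subset_left h⟩
  obtain ⟨N, hsub, hN, hNe⟩ := hp.exists_measurable_subset_ae_eq
  rw [← measure_congr hNe]
  by_contra h0
  have key : ∀ F ⊆ N, IsTestSet μ F → μ F = 0 := fun F hF hT => by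
    have := h F hT
    rwa [inter_eq_self_of_subset_right (hF.trans hsub)] at this
  by_cases hA : IsMeasureAtom μ N
  · exact h0 (key N subset_rfl (Or.inl hA))
  · simp only [IsMeasureAtom, not_and, not_forall, not_or] at hA
    obtain ⟨F, hFN, hF, hF0, hF1⟩ := hA hN h0
    have hfin : μ F < ∞ := by
      refine lt_of_le_of_ne le_top fun hT => hF1 ?_
      rw [hT, eq_comm, eq_top_iff, ← hT]
      exact measure_mono hFN
    have : IsFiniteMeasure (μ.restrict F) := ⟨by simpa using hfin⟩
    exact hF0 (key F hFN (Or.inr ⟨hF, inferInstance⟩))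

/-- The exhausting integral of a family `α A`, `A` in the `σ`-ring of countable unions of atoms
and a `σ`-finite set: the suprema of the integrals of the positive and of the negative parts are
subtracted, with the convention `∞ - ∞ = ∞`. -/
def exhIntegralFamily (μ : Measure Ω) (α : Set Ω → Ω → EReal) : EReal :=
  let P : ℝ≥0∞ := ⨆ A ∈ atomSigmaRing μ, ∫⁻ ω in A, (α A ω).toENNReal ∂μ
  let N : ℝ≥0∞ := ⨆ A ∈ atomSigmaRing μ, ∫⁻ ω in A, (-α A ω).toENNReal ∂μ
  if P = ∞ then ⊤ else (P : EReal) - (N : EReal)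

/-- The exhausting integral of a single function. -/
def exhIntegral (μ : Measure Ω) (α : Ω → EReal) : EReal :=
  exhIntegralFamily μ fun _ => α

/-- The integral functional `I_f`. -/
def integralFunctional (μ : Measure Ω) (f : Ω → M → EReal) (u : Ω → M) : EReal :=
  exhIntegral μ fun ω => f ω (u ω)

/-- `m` is the essential infimum function of the family `v` on `A`: the greatest lower bound
almost everywhere on `A` among functions that are measurable for the completion. -/
def IsEssInfOn {ι : Type*} (μ : Measure Ω) (A : Set Ω) (v : ι → Ω → EReal) (m : Ω → EReal) :
    Prop :=
  AEMeasurable m (μ.restrict A) ∧ (∀ i, ∀ᵐ ω ∂μ.restrict A, m ω ≤ v i ω) ∧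
    ∀ n : Ω → EReal, AEMeasurable n (μ.restrict A) →
      (∀ i, ∀ᵐ ω ∂μ.restrict A, n ω ≤ v i ω) → ∀ᵐ ω ∂μ.restrict A, n ω ≤ m ω

/-- `m` is the essential infimum function of the family `v` on the whole space, for families
whose members need only be integrally measurable. -/
def IsEssInf {ι : Type*} (μ : Measure Ω) (v : ι → Ω → EReal) (m : Ω → EReal) : Prop :=
  AEMeasurable m μ ∧ (∀ i, IntAE μ fun ω => m ω ≤ v i ω) ∧
    ∀ n : Ω → EReal, AEMeasurable n μ →
      (∀ i, IntAE μ fun ω => n ω ≤ v i ω) → ∀ᵐ ω ∂μ, n ω ≤ m ω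

/-- The pointwise infimum `ω ↦ inf_W f(ω, ·)`. -/
def infOver (f : Ω → M → EReal) (W : Set M) (ω : Ω) : EReal := ⨅ x ∈ W, f ω x

/-- The family `inf_W f` indexed by the separable subsets `W` of `M`. -/
def infFamily [TopologicalSpace M] (f : Ω → M → EReal) (W : {W : Set M // IsSeparable W}) :
    Ω → EReal :=
  infOver f W.1

/-- Integral strong measurability: strong measurability on every atom and `σ`-finite set. -/
def IntStronglyMeasurable [TopologicalSpace M] (μ : Measure Ω) (u : Ω → M) : Prop :=
  ∀ A, IsTestSet μ A → StronglyMeasurable fun ω : A => u ω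

/-- Integral separable measurability: for `W` separable and `A` an atom or a `σ`-finite set, the
restriction of the integrand to `A × W` is product measurable. -/
def IntSeparablyMeasurable [TopologicalSpace M] [MeasurableSpace M] (μ : Measure Ω)
    (f : Ω → M → EReal) : Prop :=
  ∀ A, IsTestSet μ A → ∀ W : Set M, IsSeparable W →
    Measurable fun p : A × W => f p.1 p.2

open Classical in
/-- Almost decomposability of a space of functions. Only the restriction of `u₁` to `F`
matters. -/
def AlmostDecomposable [PseudoMetricSpace M] (μ : Measure Ω) (R : Set (Ω → M)) : Prop :=
  ∀ u₀ ∈ R, ∀ F : Set Ω, MeasurableSet F → μ F < ∞ → ∀ ε : ℝ≥0∞, 0 < ε →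
    ∀ u₁ : Ω → M, StronglyMeasurable (fun ω : F => u₁ ω) → Bornology.IsBounded (u₁ '' F) →
      ∃ G ⊆ F, MeasurableSet G ∧ μ (F \ G) < ε ∧ G.piecewise u₁ u₀ ∈ R

end InfInt

end

namespace InfInt

open scoped NNReal

section Selection

/-- A product measurable set depends on the first variable only through a measurable map to the
Cantor space. -/
theorem exists_factor_cantor {Ω X : Type*} [MeasurableSpace Ω] [MeasurableSpace X]
    {G : Set (Ω × X)} (hG : MeasurableSet G) :
    ∃ φ : Ω → ℕ → Bool, Measurable φ ∧ ∃ G' : Set ((ℕ → Bool) × X), MeasurableSet G' ∧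
      G = Prod.map φ id ⁻¹' G' := by
  classical
  rw [← generateFrom_prod] at hG
  induction G, hG using MeasurableSpace.generateFrom_induction with
  | hC t ht _ =>
    obtain ⟨s, hs, t, ht', rfl⟩ := ht
    refine ⟨fun ω _ => decide (ω ∈ s), ?_, ((fun y => y 0) ⁻¹' {true}) ×ˢ t, ?_, ?_⟩
    · refine measurable_pi_lambda _ fun _ => ?_
      refine measurable_to_bool ?_
      simpa [preimage] using hs
    · exact ((measurable_pi_apply 0) (measurableSet_singleton _)).prod ht'
    · ext ⟨ω, x⟩
      simp
  | empty => exact ⟨fun _ _ => true, measurable_const, ∅, .empty, by simp⟩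
  | compl t _ ih =>
    obtain ⟨φ, hφ, G', hG', rfl⟩ := ih
    exact ⟨φ, hφ, G'ᶜ, hG'.compl, by simp⟩
  | iUnion s _ ih =>
    choose φ hφ G' hG' hs using ih
    let e := cantorSpaceHomeomorphNatToCantorSpace
    refine ⟨fun ω => e.symm fun n => φ n ω, ?_,
      ⋃ n, Prod.map (fun y => e y n) id ⁻¹' G' n, ?_, ?_⟩
    · exact e.symm.continuous.measurable.comp (measurable_pi_lambda _ hφ)
    · refine .iUnion fun n => ?_
      refine Measurable.prodMap ?_ measurable_id (hG' n)
      exact ((continuous_apply n).comp e.continuous).measurable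
    · ext ⟨ω, x⟩
      simp only [mem_iUnion, mem_preimage, Prod.map_apply, id, Homeomorph.apply_symm_apply]
      refine exists_congr fun n => ?_
      rw [hs n]
      simp

/-- An open neighbourhood of the box `{x | x ≤ n}` in the Baire space contains the set of
all `x` whose first `k` coordinates are bounded by those of `n`, for some `k`. -/
theorem exists_cylinder_subset_of_box_subset {n : ℕ → ℕ} {O : Set (ℕ → ℕ)} (hO : IsOpen O)
    (hn : Set.Iic n ⊆ O) : ∃ k, {x : ℕ → ℕ | ∀ i < k, x i ≤ n i} ⊆ O := by
  have hK : IsCompact (Set.Iic n) := by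
    have : Set.Iic n = Set.Icc 0 n := by ext; simp
    rw [this]; exact isCompact_Icc
  have key : ∃ k, ∀ x : ℕ → ℕ, (∀ i < k, x i ≤ n i) → x ⊓ n ∈ Set.Iic n → x ∈ O := by
    refine hK.induction_on (p := fun T => ∃ k, ∀ x : ℕ → ℕ, (∀ i < k, x i ≤ n i) →
      x ⊓ n ∈ T → x ∈ O) ⟨0, by simp⟩ ?_ ?_ ?_
    · rintro s t hst ⟨k, hk⟩
      exact ⟨k, fun x hx hs => hk x hx (hst hs)⟩
    · rintro s t ⟨k, hk⟩ ⟨l, hl⟩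
      refine ⟨max k l, fun x hx hs => hs.elim (hk x fun i hi => hx i (lt_max_of_lt_left hi))
        (hl x fun i hi => hx i (lt_max_of_lt_right hi))⟩
    · intro z hz
      obtain ⟨_, ⟨y, k, rfl⟩, hzy, hyO⟩ :=
        (PiNat.isTopologicalBasis_cylinders (fun _ => ℕ)).exists_subset_of_mem_open (hn hz) hO
      rw [← PiNat.mem_cylinder_iff_eq.1 hzy] at hyO
      refine ⟨PiNat.cylinder z k, mem_nhdsWithin_of_mem_nhds
        ((PiNat.isOpen_cylinder (fun _ => ℕ) z k).mem_nhds (PiNat.self_mem_cylinder z k)), k, ?_⟩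
      intro x hx hxz
      refine hyO fun i hi => ?_
      rw [← hxz i hi]
      simpa using hx i hi
  obtain ⟨k, hk⟩ := key
  exact ⟨k, fun x hx => hk x hx (inf_le_right : x ⊓ n ≤ n)⟩

/-- The continuous image of the Baire space can be approximated in measure from within by images
of compact sets. -/
theorem exists_isCompact_le_measure_image {Y : Type*} [TopologicalSpace Y] [T2Space Y]
    [MeasurableSpace Y] [OpensMeasurableSpace Y] (ν : Measure Y) [IsFiniteMeasure ν]
    {g : (ℕ → ℕ) → Y} (hg : Continuous g) {c : ℝ≥0∞} (hc : c < ν (range g)) :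
    ∃ n : ℕ → ℕ, c ≤ ν (g '' Set.Iic n) := by
  have step : ∀ (S : Set (ℕ → ℕ)) (k : ℕ), c < ν (g '' S) →
      ∃ l, c < ν (g '' (S ∩ {x | x k ≤ l})) := by
    intro S k hS
    have hmono : Monotone fun l => g '' (S ∩ {x : ℕ → ℕ | x k ≤ l}) := fun a b hab =>
      image_mono (inter_subset_inter_right _ fun x (hx : x k ≤ a) => hx.trans hab)
    have hun : g '' S = ⋃ l, g '' (S ∩ {x : ℕ → ℕ | x k ≤ l}) := by
      rw [← image_iUnion, ← inter_iUnion]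
      congr 1
      refine (inter_eq_left.2 fun x _ => mem_iUnion.2 ⟨x k, le_refl (x k)⟩).symm
    rw [hun, hmono.measure_iUnion, lt_iSup_iff] at hS
    exact hS
  choose! l hl using step
  let S : ℕ → Set (ℕ → ℕ) := fun k =>
    Nat.rec univ (fun k S => S ∩ {x | x k ≤ l S k}) k
  have hS : ∀ k, c < ν (g '' S k) := by
    intro k
    induction k with
    | zero => simpa [S] using hc
    | succ k ih => exact hl _ _ ih
  let n : ℕ → ℕ := fun k => l (S k) k
  have hSn : ∀ k, S k = {x | ∀ i < k, x i ≤ n i} := by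
    intro k
    induction k with
    | zero => simp [S]
    | succ k ih =>
      have : S (k + 1) = S k ∩ {x | x k ≤ n k} := rfl
      rw [this, ih]
      ext x
      simp only [mem_inter_iff, mem_ofPred_eq]
      exact Nat.forall_lt_succ_right.symm
  refine ⟨n, ?_⟩
  have hK : IsCompact (Set.Iic n) := by
    have : Set.Iic n = Set.Icc 0 n := by ext; simp
    rw [this]; exact isCompact_Icc
  have hsub : ⋂ k, closure (g '' S k) ⊆ g '' Set.Iic n := by
    intro y hy
    by_contra hyK
    obtain ⟨U, V, hU, hV, hKU, hyV, hUV⟩ :=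
      SeparatedNhds.of_isCompact_isCompact (hK.image hg) (isCompact_singleton (x := y))
        (disjoint_singleton_right.2 hyK)
    obtain ⟨k, hk⟩ := exists_cylinder_subset_of_box_subset (hU.preimage hg) (image_subset_iff.1 hKU)
    have h1 : closure (g '' S k) ⊆ closure U := closure_mono (image_subset_iff.2 (hSn k ▸ hk))
    exact (hUV.closure_left hV).le_bot ⟨h1 (mem_iInter.1 hy k), hyV rfl⟩
  refine le_trans ?_ (measure_mono hsub)
  have hanti : Antitone fun k => closure (g '' S k) := by
    refine antitone_nat_of_succ_le fun k => closure_mono (image_mono ?_)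
    exact inter_subset_left
  rw [hanti.measure_iInter (fun k => isClosed_closure.measurableSet.nullMeasurableSet)
    ⟨0, measure_ne_top _ _⟩]
  exact le_iInf fun k => (hS k).le.trans (measure_mono subset_closure)

/-- A continuous map on a compact set of reals has a Borel measurable right inverse on its
range. -/
theorem exists_measurable_section {Y : Type*} [TopologicalSpace Y] [T2Space Y]
    [MeasurableSpace Y] [OpensMeasurableSpace Y] {Z : Set ℝ} (hZ : IsCompact Z)
    {g : Z → Y} (hg : Continuous g) :
    ∃ σ : range g → Z, Measurable σ ∧ ∀ y, g (σ y) = y := by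
  have : CompactSpace Z := isCompact_iff_compactSpace.1 hZ
  let fib : Y → Set ℝ := fun y => Subtype.val '' (g ⁻¹' {y})
  have hfib : ∀ y, IsCompact (fib y) := fun y =>
    ((isClosed_singleton.preimage hg).isCompact).image continuous_subtype_val
  have hmem : ∀ y : range g, sInf (fib y) ∈ fib y := by
    rintro ⟨_, z, rfl⟩
    exact (hfib _).sInf_mem ⟨z, z, rfl, rfl⟩
  choose σ hσ hσ' using hmem
  refine ⟨σ, ?_, fun y => hσ y⟩
  refine MeasurableEmbedding.subtype_coe hZ.measurableSet |>.measurable_comp_iff.1 ?_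
  refine measurable_of_Iic fun c => ?_
  have : (Subtype.val ∘ σ) ⁻¹' Set.Iic c = Subtype.val ⁻¹' (g '' {z : Z | (z : ℝ) ≤ c}) := by
    ext y
    simp only [mem_preimage, Function.comp_apply, mem_Iic, mem_image, mem_ofPred_eq]
    refine ⟨fun h => ⟨σ y, h, hσ y⟩, fun ⟨z, hz, hzy⟩ => ?_⟩
    rw [hσ' y]
    exact (csInf_le (hfib y).bddBelow ⟨z, hzy, rfl⟩).trans hz
  rw [this]
  refine measurable_subtype_coe
    (IsCompact.measurableSet (IsCompact.image (IsClosed.isCompact ?_) hg))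
  exact isClosed_le continuous_subtype_val continuous_const

/-- Measurable selection up to a set of small measure: a product measurable set contains the graph
of a measurable function defined on a measurable set whose measure is as close as desired to that
of the projection. -/
theorem exists_measurable_selection {Ω X : Type*} [MeasurableSpace Ω] [TopologicalSpace X]
    [PolishSpace X] [MeasurableSpace X] [BorelSpace X] (ν : Measure Ω) [IsFiniteMeasure ν]
    {G : Set (Ω × X)} (hG : MeasurableSet G) {c : ℝ≥0∞} (hc : c < ν (Prod.fst '' G)) :
    ∃ F : Set Ω, MeasurableSet F ∧ c ≤ ν F ∧ ∃ u : F → X, Measurable u ∧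
      ∀ ω : F, ((ω : Ω), u ω) ∈ G := by
  obtain ⟨φ, hφ, G', hG', rfl⟩ := exists_factor_cantor hG
  have hne : G'.Nonempty := by
    by_contra h
    rw [not_nonempty_iff_eq_empty] at h
    simp [h] at hc
  have : PolishSpace cantorSet := isClosed_cantorSet.polishSpace
  have : PolishSpace (ℕ → Bool) := cantorSetHomeomorphNatToBool.symm.isClosedEmbedding.polishSpace
  obtain h0 | ⟨g, hg, hgr⟩ := by simpa only [AnalyticSet] using hG'.analyticSet
  · exact absurd h0 hne.ne_empty
  have hc' : c < (ν.map φ) (range (Prod.fst ∘ g)) := by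
    refine hc.trans_le (le_trans (measure_mono ?_) (Measure.le_map_apply hφ.aemeasurable _))
    rintro _ ⟨⟨ω, x⟩, h, rfl⟩
    rw [← hgr] at h
    obtain ⟨z, hz⟩ := h
    exact ⟨z, by simp [hz]⟩
  obtain ⟨n, hn⟩ := exists_isCompact_le_measure_image (ν.map φ) (continuous_fst.comp hg) hc'
  have hK : IsCompact (Set.Iic n) := by
    have : Set.Iic n = Set.Icc 0 n := by ext; simp
    rw [this]; exact isCompact_Icc
  have : CompactSpace (Set.Iic n) := isCompact_iff_compactSpace.1 hK
  let : MetricSpace (Set.Iic n) := metrizableSpaceMetric _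
  have : Nonempty (Set.Iic n) := ⟨n, mem_Iic.2 le_rfl⟩
  obtain ⟨p, hp, hps⟩ := exists_nat_bool_continuous_surjective_of_compact (Set.Iic n)
  let h : cantorSet → (ℕ → Bool) × X := fun z => g (p (cantorSetHomeomorphNatToBool z))
  have hh : Continuous h :=
    hg.comp (continuous_subtype_val.comp (hp.comp cantorSetHomeomorphNatToBool.continuous))
  obtain ⟨σ, hσ, hσ'⟩ := exists_measurable_section isCompact_cantorSet (continuous_fst.comp hh)
  have hr : range (Prod.fst ∘ h) = (Prod.fst ∘ g) '' Set.Iic n := by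
    refine Subset.antisymm ?_ ?_
    · rintro _ ⟨z, rfl⟩
      exact ⟨_, (p (cantorSetHomeomorphNatToBool z)).2, rfl⟩
    · rintro _ ⟨x, hx, rfl⟩
      obtain ⟨b, hb⟩ := hps ⟨x, hx⟩
      exact ⟨cantorSetHomeomorphNatToBool.symm b, by simp [h, hb]⟩
  have hrm : MeasurableSet (range (Prod.fst ∘ h)) := by
    rw [hr]
    exact (hK.image (continuous_fst.comp hg)).measurableSet
  refine ⟨φ ⁻¹' range (Prod.fst ∘ h), hφ hrm, ?_,
    fun ω => (h (σ ⟨φ ω, ω.2⟩)).2, ?_, ?_⟩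
  · rwa [← Measure.map_apply hφ hrm, hr]
  · exact measurable_snd.comp (hh.measurable.comp (hσ.comp
      ((hφ.comp measurable_subtype_coe).subtype_mk)))
  · intro ω
    have h1 : (h (σ ⟨φ ω, ω.2⟩)).1 = φ ω := hσ' ⟨φ ω, ω.2⟩
    have h2 : h (σ ⟨φ ω, ω.2⟩) ∈ G' := hgr ▸ mem_range_self _
    have h3 : Prod.map φ id ((ω : Ω), (h (σ ⟨φ ω, ω.2⟩)).2) = h (σ ⟨φ ω, ω.2⟩) :=
      Prod.ext h1.symm rfl
    rwa [mem_preimage, h3]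

/-- The projection of a product measurable set along a Polish space is measurable for the
completion of a finite measure. -/
theorem nullMeasurableSet_image_fst {Ω X : Type*} [MeasurableSpace Ω] [TopologicalSpace X]
    [PolishSpace X] [MeasurableSpace X] [BorelSpace X] (ν : Measure Ω) [IsFiniteMeasure ν]
    {G : Set (Ω × X)} (hG : MeasurableSet G) : NullMeasurableSet (Prod.fst '' G) ν := by
  have key : ∀ n : ℕ, ∃ F, MeasurableSet F ∧ F ⊆ Prod.fst '' G ∧
      ν (Prod.fst '' G) - 1 / (n + 1) ≤ ν F := by
    intro n
    rcases eq_or_ne (ν (Prod.fst '' G)) 0 with h0 | h0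
    · exact ⟨∅, .empty, empty_subset _, by simp [h0]⟩
    obtain ⟨F, hF, hc, u, -, hu⟩ := exists_measurable_selection ν hG
      (ENNReal.sub_lt_self (measure_ne_top _ _) h0 (b := 1 / ((n : ℝ≥0∞) + 1)) (by simp))
    exact ⟨F, hF, fun ω hω => ⟨_, hu ⟨ω, hω⟩, rfl⟩, hc⟩
  choose F hF hFs hFν using key
  have hU : MeasurableSet (⋃ n, F n) := .iUnion hF
  have hUs : (⋃ n, F n) ⊆ Prod.fst '' G := iUnion_subset hFs
  refine hU.nullMeasurableSet.congr (ae_eq_of_subset_of_measure_ge hUs ?_ hU.nullMeasurableSet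
    (measure_ne_top _ _))
  refine ENNReal.le_of_forall_pos_le_add fun ε hε _ => ?_
  obtain ⟨n, hn⟩ := ENNReal.exists_inv_nat_lt (ENNReal.coe_pos.2 hε).ne'
  refine (tsub_le_iff_right.1 (hFν n)).trans (add_le_add (measure_mono (subset_iUnion F n)) ?_)
  refine le_trans ?_ hn.le
  rw [one_div]
  exact ENNReal.inv_le_inv.2 le_self_add

end Selection

/-- A monotone function on a system of sets that is closed under countable unions attains its
supremum. -/
theorem exists_forall_le_of_iUnion_mem {X : Type*} {S : Set (Set X)} (hne : S.Nonempty)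
    (hS : ∀ s : ℕ → Set X, (∀ n, s n ∈ S) → ⋃ n, s n ∈ S) {Φ : Set X → ℝ≥0∞}
    (hΦ : MonotoneOn Φ S) : ∃ A ∈ S, ∀ B ∈ S, Φ B ≤ Φ A := by
  have : (Φ '' S).Nonempty := hne.image _
  obtain ⟨v, -, hv, hvS⟩ := exists_seq_tendsto_sSup this (OrderTop.bddAbove _)
  choose s hs hsv using hvS
  refine ⟨⋃ n, s n, hS s hs, fun B hB => (le_sSup (mem_image_of_mem Φ hB)).trans ?_⟩
  refine le_of_tendsto' hv fun n => ?_
  rw [← hsv n]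
  exact hΦ (hs n) (hS s hs) (subset_iUnion s n)

section TestSets

variable {Ω : Type*} [MeasurableSpace Ω] {μ : Measure Ω}

theorem isSigmaFiniteSet_of_measure_lt_top {A : Set Ω} (hA : MeasurableSet A) (h : μ A < ∞) :
    IsSigmaFiniteSet μ A := by
  have : IsFiniteMeasure (μ.restrict A) := ⟨by simpa using h⟩
  exact ⟨hA, inferInstance⟩

theorem IsSigmaFiniteSet.iUnion {ι : Type*} [Countable ι] {B : ι → Set Ω}
    (hB : ∀ i, IsSigmaFiniteSet μ (B i)) : IsSigmaFiniteSet μ (⋃ i, B i) := by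
  have hm : MeasurableSet (⋃ i, B i) := .iUnion fun i => (hB i).1
  refine ⟨hm, ?_⟩
  have := fun i => (hB i).2
  let T : Set (Set Ω) := insert (⋃ i, B i)ᶜ
    (range fun p : ι × ℕ => B p.1 ∩ spanningSets (μ.restrict (B p.1)) p.2)
  have hT : T.Countable := (countable_range _).insert _
  refine Measure.sigmaFinite_of_countable hT ?_ (eq_univ_of_forall fun x => ?_)
  · rintro _ (rfl | ⟨p, rfl⟩)
    · rw [Measure.restrict_apply hm.compl, compl_inter_self]
      simp
    · refine (Measure.restrict_le_self _).trans_lt ?_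
      change μ (B p.1 ∩ spanningSets (μ.restrict (B p.1)) p.2) < ∞
      rw [inter_comm, ← Measure.restrict_apply' (hB p.1).1]
      exact measure_spanningSets_lt_top _ _
  · by_cases hx : x ∈ ⋃ i, B i
    · obtain ⟨i, hi⟩ := mem_iUnion.1 hx
      obtain ⟨k, hk⟩ := mem_iUnion.1 (iUnion_spanningSets (μ.restrict (B i)) ▸ mem_univ x)
      exact ⟨_, .inr ⟨(i, k), rfl⟩, hi, hk⟩
    · exact ⟨_, .inl rfl, hx⟩

theorem IsTestSet.measurableSet {A : Set Ω} (hA : IsTestSet μ A) : MeasurableSet A :=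
  hA.elim (·.1) (·.1)

theorem IsTestSet.infinite_atom_or_sigmaFinite {A : Set Ω} (hA : IsTestSet μ A) :
    (IsMeasureAtom μ A ∧ μ A = ∞) ∨ IsSigmaFiniteSet μ A := by
  rcases hA with hA | hA
  · by_cases h : μ A = ∞
    · exact .inl ⟨hA, h⟩
    · exact .inr (isSigmaFiniteSet_of_measure_lt_top hA.1 (Ne.lt_top h))
  · exact .inr hA

theorem isSigmaFiniteSet_empty : IsSigmaFiniteSet μ ∅ :=
  isSigmaFiniteSet_of_measure_lt_top .empty (by simp)

theorem mem_atomSigmaRing_iff {A : Set Ω} :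
    A ∈ atomSigmaRing μ ↔ ∃ T : ℕ → Set Ω, (∀ n, IsTestSet μ (T n)) ∧ A = ⋃ n, T n := by
  constructor
  · rintro ⟨C, hC, hCa, B, hB, rfl⟩
    obtain ⟨T, hT⟩ := (hC.insert B).exists_eq_range (insert_nonempty _ _)
    refine ⟨T, fun n => ?_, ?_⟩
    · have : T n ∈ insert B C := hT ▸ mem_range_self n
      rcases this with h | h
      · exact .inr (h ▸ hB)
      · exact .inl (hCa _ h)
    · rw [← sUnion_range, ← hT, sUnion_insert, union_comm]
  · rintro ⟨T, hT, rfl⟩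
    refine ⟨range T ∩ {S | IsMeasureAtom μ S}, (countable_range T).mono inter_subset_left,
      fun S hS => hS.2, ⋃ n : {n // IsSigmaFiniteSet μ (T n)}, T n,
      IsSigmaFiniteSet.iUnion fun n => n.2, ?_⟩
    refine Subset.antisymm (iUnion_subset fun n => ?_) (union_subset ?_ ?_)
    · rcases hT n with h | h
      · exact subset_union_of_subset_left (subset_sUnion_of_mem (mem_inter (mem_range_self n) h)) _
      · exact subset_union_of_subset_right
          (subset_iUnion (fun n : {n // IsSigmaFiniteSet μ (T n)} => T n) ⟨n, h⟩) _
    · rintro x ⟨_, ⟨⟨n, rfl⟩, -⟩, hx⟩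
      exact mem_iUnion_of_mem n hx
    · exact iUnion_subset fun n => subset_iUnion T n

theorem IsTestSet.mem_atomSigmaRing {A : Set Ω} (hA : IsTestSet μ A) : A ∈ atomSigmaRing μ :=
  mem_atomSigmaRing_iff.2 ⟨fun _ => A, fun _ => hA, (iUnion_const A).symm⟩

theorem measurableSet_of_mem_atomSigmaRing {A : Set Ω} (hA : A ∈ atomSigmaRing μ) :
    MeasurableSet A := by
  obtain ⟨T, hT, rfl⟩ := mem_atomSigmaRing_iff.1 hA
  exact .iUnion fun n => (hT n).measurableSet

theorem iUnion_mem_atomSigmaRing {A : ℕ → Set Ω} (hA : ∀ n, A n ∈ atomSigmaRing μ) :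
    ⋃ n, A n ∈ atomSigmaRing μ := by
  choose T hT hAT using fun n => mem_atomSigmaRing_iff.1 (hA n)
  refine mem_atomSigmaRing_iff.2
    ⟨fun k => T k.unpair.1 k.unpair.2, fun k => hT _ _, ?_⟩
  simp_rw [hAT]
  exact (iUnion_unpair T).symm

theorem union_mem_atomSigmaRing {A B : Set Ω} (hA : A ∈ atomSigmaRing μ)
    (hB : B ∈ atomSigmaRing μ) : A ∪ B ∈ atomSigmaRing μ := by
  have : A ∪ B = ⋃ n : ℕ, if n = 0 then A else B := by
    ext x
    simp only [mem_union, mem_iUnion]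
    refine ⟨fun h => h.elim (fun h => ⟨0, by simpa⟩) (fun h => ⟨1, by simpa⟩), ?_⟩
    rintro ⟨n, hn⟩
    split_ifs at hn
    exacts [.inl hn, .inr hn]
  rw [this]
  exact iUnion_mem_atomSigmaRing fun n => by split_ifs <;> assumption

theorem atomSigmaRing_nonempty : (atomSigmaRing μ).Nonempty :=
  ⟨∅, IsTestSet.mem_atomSigmaRing (.inr isSigmaFiniteSet_empty)⟩

/-- The supremum of a monotone set function over the `σ`-ring is attained, with the maximizer
containing any prescribed member. -/
theorem exists_superset_forall_le {Φ : Set Ω → ℝ≥0∞} (hΦ : MonotoneOn Φ (atomSigmaRing μ))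
    {A₀ : Set Ω} (hA₀ : A₀ ∈ atomSigmaRing μ) :
    ∃ A ∈ atomSigmaRing μ, A₀ ⊆ A ∧ ∀ B ∈ atomSigmaRing μ, Φ B ≤ Φ A := by
  obtain ⟨A, hA, h⟩ := exists_forall_le_of_iUnion_mem atomSigmaRing_nonempty
    (fun _ => iUnion_mem_atomSigmaRing) hΦ
  have hU := union_mem_atomSigmaRing hA₀ hA
  exact ⟨A₀ ∪ A, hU, subset_union_left, fun B hB => (h B hB).trans (hΦ hA hU subset_union_right)⟩

theorem intAE_iff_forall_ae_restrict {p : Ω → Prop} :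
    IntAE μ p ↔ ∀ A, IsTestSet μ A → ∀ᵐ ω ∂μ.restrict A, p ω := by
  refine forall₂_congr fun A hA => ?_
  rw [ae_iff, Measure.restrict_apply' hA.measurableSet]

theorem ae_restrict_of_forall_testSet {p : Ω → Prop} {A : Set Ω} (hA : A ∈ atomSigmaRing μ)
    (h : ∀ T ⊆ A, IsTestSet μ T → ∀ᵐ ω ∂μ.restrict T, p ω) : ∀ᵐ ω ∂μ.restrict A, p ω := by
  obtain ⟨T, hT, rfl⟩ := mem_atomSigmaRing_iff.1 hA
  exact (ae_restrict_iUnion_iff T p).2 fun n => h _ (subset_iUnion T n) (hT n)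

theorem IntAE.ae_restrict {p : Ω → Prop} (h : IntAE μ p) {A : Set Ω}
    (hA : A ∈ atomSigmaRing μ) : ∀ᵐ ω ∂μ.restrict A, p ω :=
  ae_restrict_of_forall_testSet hA fun T _ hT => intAE_iff_forall_ae_restrict.1 h T hT

theorem aemeasurable_restrict_of_forall_testSet {β : Type*} [MeasurableSpace β] {φ : Ω → β}
    {A : Set Ω} (hA : A ∈ atomSigmaRing μ)
    (h : ∀ T ⊆ A, IsTestSet μ T → AEMeasurable φ (μ.restrict T)) :
    AEMeasurable φ (μ.restrict A) := by
  obtain ⟨T, hT, rfl⟩ := mem_atomSigmaRing_iff.1 hA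
  exact aemeasurable_iUnion_iff.2 fun n => h _ (subset_iUnion T n) (hT n)

/-- A member of the `σ`-ring has a `σ`-finite part outside of which a property holds almost
everywhere as soon as it holds almost everywhere on atoms of infinite measure. -/
theorem exists_sigmaFinite_part {A : Set Ω} (hA : A ∈ atomSigmaRing μ) :
    ∃ B ⊆ A, IsSigmaFiniteSet μ B ∧ ∀ p : Ω → Prop,
      (∀ T ⊆ A, IsMeasureAtom μ T → μ T = ∞ → ∀ᵐ ω ∂μ.restrict T, p ω) →
        ∀ᵐ ω ∂μ.restrict A, ω ∉ B → p ω := by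
  obtain ⟨T, hT, rfl⟩ := mem_atomSigmaRing_iff.1 hA
  refine ⟨⋃ n : {n // IsSigmaFiniteSet μ (T n)}, T n, iUnion_subset fun n => subset_iUnion T n,
      IsSigmaFiniteSet.iUnion fun n => n.2, fun p hp => ?_⟩
  refine (ae_restrict_iUnion_iff T _).2 fun n => ?_
  rcases (hT n).infinite_atom_or_sigmaFinite with h | h
  · filter_upwards [hp _ (subset_iUnion T n) h.1 h.2] with ω hω _ using hω
  · filter_upwards [ae_restrict_mem (hT n).measurableSet] with ω hω hω'
    exact absurd (mem_iUnion.2 ⟨⟨n, h⟩, hω⟩) hω'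

/-- A function with finite integral vanishes almost everywhere on an atom of infinite measure. -/
theorem IsMeasureAtom.ae_eq_zero {T : Set Ω} (hT : IsMeasureAtom μ T) (hTi : μ T = ∞)
    {φ : Ω → ℝ≥0∞} (hφ : AEMeasurable φ (μ.restrict T)) (hi : ∫⁻ ω in T, φ ω ∂μ ≠ ∞) :
    ∀ᵐ ω ∂μ.restrict T, φ ω = 0 := by
  have key : ∀ n : ℕ, (μ.restrict T) {ω | (n + 1 : ℝ≥0∞)⁻¹ ≤ φ ω} = 0 := by
    intro n
    have hlt : (μ.restrict T) {ω | (n + 1 : ℝ≥0∞)⁻¹ ≤ φ ω} < ∞ :=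
      (meas_ge_le_lintegral_div hφ (by simp) (by simp)).trans_lt (ENNReal.div_lt_top hi (by simp))
    have hnull : NullMeasurableSet {ω | (n + 1 : ℝ≥0∞)⁻¹ ≤ φ ω} (μ.restrict T) :=
      nullMeasurableSet_le aemeasurable_const hφ
    obtain ⟨E, -, hEm, hEe⟩ := hnull.exists_measurable_superset_ae_eq
    rw [← measure_congr hEe, Measure.restrict_apply hEm] at hlt ⊢
    refine (hT.2.2 (E ∩ T) inter_subset_right (hEm.inter hT.1)).resolve_right fun h => ?_
    rw [h, hTi] at hlt
    exact lt_irrefl _ hlt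
  have : ∀ᵐ ω ∂μ.restrict T, ∀ n : ℕ, φ ω < (n + 1 : ℝ≥0∞)⁻¹ :=
    ae_all_iff.2 fun n => by
      rw [ae_iff]
      simpa using key n
  filter_upwards [this] with ω hω
  by_contra h0
  obtain ⟨n, hn⟩ := ENNReal.exists_inv_nat_lt h0
  exact lt_irrefl _ (((hω n).trans_le (ENNReal.inv_le_inv.2 le_self_add)).trans hn)

end TestSets

section Infimum

theorem infOver_anti {Ω M : Type*} (f : Ω → M → EReal) {V W : Set M} (h : V ⊆ W) (ω : Ω) :
    infOver f W ω ≤ infOver f V ω :=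
  biInf_mono fun _ hx => h hx

theorem infOver_le {Ω M : Type*} (f : Ω → M → EReal) {W : Set M} {x : M} (hx : x ∈ W) (ω : Ω) :
    infOver f W ω ≤ f ω x :=
  biInf_le _ hx

theorem infOver_lt_iff {Ω M : Type*} (f : Ω → M → EReal) {W : Set M} {ω : Ω} {c : EReal} :
    infOver f W ω < c ↔ ∃ x ∈ W, f ω x < c := by
  simp [infOver, iInf_lt_iff]

variable {Ω M : Type*} [MeasurableSpace Ω] {μ : Measure Ω}

/-- Measurability of sets of pairs does not depend on whether the first variable is restricted to
a measurable set. -/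
theorem measurableSet_image_prodMap_val {X : Type*} [MeasurableSpace X] {T : Set Ω}
    (hT : MeasurableSet T) {G : Set (T × X)} (hG : MeasurableSet G) :
    MeasurableSet (Prod.map Subtype.val id '' G : Set (Ω × X)) :=
  ((MeasurableEmbedding.subtype_coe hT).prodMap MeasurableEmbedding.id).measurableSet_image.2 hG

theorem nullMeasurableSet_image_fst_restrict {X : Type*} [TopologicalSpace X]
    [PolishSpace X] [MeasurableSpace X] [BorelSpace X] {T : Set Ω} (hT : IsSigmaFiniteSet μ T)
    {G : Set (Ω × X)} (hG : MeasurableSet G) :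
    NullMeasurableSet (Prod.fst '' G) (μ.restrict T) := by
  have := hT.2
  exact (nullMeasurableSet_image_fst (μ.restrict T).toFinite hG).mono_ac
    (absolutelyContinuous_toFinite _)

theorem aemeasurable_of_nullMeasurableSet_lt {ν : Measure Ω} {φ : Ω → EReal}
    (h : ∀ c, NullMeasurableSet {ω | φ ω < c} ν) : AEMeasurable φ ν := by
  refine NullMeasurable.aemeasurable ?_
  intro s hs
  exact (measurable_of_Iio (f := φ) (δ := NullMeasurableSpace Ω ν) h) hs

variable [MetricSpace M] {f : Ω → M → EReal}

theorem IntStronglyMeasurable.isSeparable_image {u : Ω → M} (hu : IntStronglyMeasurable μ u)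
    {A : Set Ω} (hA : A ∈ atomSigmaRing μ) : IsSeparable (u '' A) := by
  obtain ⟨T, hT, rfl⟩ := mem_atomSigmaRing_iff.1 hA
  rw [image_iUnion]
  refine IsSeparable.iUnion fun n => ?_
  rw [image_eq_range]
  exact (hu (T n) (hT n)).isSeparable_range

theorem IntSeparablyMeasurable.measurable_comp [MeasurableSpace M] [BorelSpace M]
    (hf : IntSeparablyMeasurable μ f) {u : Ω → M}
    (hu : IntStronglyMeasurable μ u) {T : Set Ω} (hT : IsTestSet μ T) :
    Measurable fun ω : T => f ω (u ω) := by
  have hsep := hu.isSeparable_image hT.mem_atomSigmaRing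
  have h1 : Measurable fun ω : T => (ω, (⟨u ω, mem_image_of_mem u ω.2⟩ : u '' T)) :=
    measurable_id.prodMk (hu T hT).measurable.subtype_mk
  exact (hf T hT _ hsep).comp h1

theorem IntSeparablyMeasurable.aemeasurable_comp [MeasurableSpace M] [BorelSpace M]
    (hf : IntSeparablyMeasurable μ f) {u : Ω → M}
    (hu : IntStronglyMeasurable μ u) {A : Set Ω} (hA : A ∈ atomSigmaRing μ) :
    AEMeasurable (fun ω => f ω (u ω)) (μ.restrict A) :=
  aemeasurable_restrict_of_forall_testSet hA fun _ _ hT =>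
    aemeasurable_restrict_of_measurable_subtype hT.measurableSet (hf.measurable_comp hu hT)

theorem IntSeparablyMeasurable.aemeasurable_infOver [CompleteSpace M] [MeasurableSpace M] [BorelSpace M]
    (hf : IntSeparablyMeasurable μ f)
    {W : Set M} (hW : IsSeparable W) (hWc : IsClosed W) {T : Set Ω} (hT : IsSigmaFiniteSet μ T) :
    AEMeasurable (infOver f W) (μ.restrict T) := by
  have : SeparableSpace W := hW.separableSpace
  have : CompleteSpace W := hWc.completeSpace_coe
  refine aemeasurable_of_nullMeasurableSet_lt fun c => ?_
  have hG : MeasurableSet {p : T × W | f p.1 p.2 < c} :=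
    measurableSet_lt (hf T (.inr hT) W hW) measurable_const
  refine (nullMeasurableSet_image_fst_restrict hT
    (measurableSet_image_prodMap_val hT.1 hG)).congr ?_
  filter_upwards [ae_restrict_mem hT.1] with ω hω
  refine propext (Iff.trans ?_ (infOver_lt_iff f).symm)
  constructor
  · rintro ⟨_, ⟨⟨ω', x⟩, h, rfl⟩, rfl⟩
    exact ⟨x, x.2, h⟩
  · rintro ⟨x, hx, h⟩
    exact ⟨_, ⟨(⟨ω, hω⟩, ⟨x, hx⟩), h, rfl⟩, rfl⟩

/-- On a `σ`-finite set, some closed separable set attains the essential infimum. -/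
theorem IntSeparablyMeasurable.exists_isSeparable_forall_infOver_le_of_sigmaFinite
    [CompleteSpace M] [MeasurableSpace M] [BorelSpace M]
    (hf : IntSeparablyMeasurable μ f) {B : Set Ω} (hB : IsSigmaFiniteSet μ B) :
    ∃ W : Set M, IsSeparable W ∧ ∀ W' : Set M, IsSeparable W' →
      ∀ᵐ ω ∂μ.restrict B, infOver f W ω ≤ infOver f W' ω := by
  have := hB.2
  let ν := (μ.restrict B).toFinite
  have key : ∀ q : ℚ, ∃ W : Set M, IsSeparable W ∧ ∀ W' : Set M, IsSeparable W' →
      ν {ω | infOver f W' ω < (q : ℝ)} ≤ ν {ω | infOver f W ω < (q : ℝ)} := fun q =>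
    exists_forall_le_of_iUnion_mem (S := {W : Set M | IsSeparable W}) ⟨∅, countable_empty.isSeparable⟩
      (fun s hs => IsSeparable.iUnion hs)
      (fun V _ W _ hVW => measure_mono fun ω hω => (infOver_anti f hVW ω).trans_lt hω)
  choose W hW hWmax using key
  have hU : IsSeparable (closure (⋃ q, W q)) := (IsSeparable.iUnion hW).closure
  refine ⟨closure (⋃ q, W q), hU, fun W' hW' => ?_⟩
  let W'' := closure (closure (⋃ q, W q) ∪ W')
  have hW'' : IsSeparable W'' := (hU.union hW').closure
  have hUW : closure (⋃ q, W q) ⊆ W'' := subset_union_left.trans subset_closure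
  have hae : ∀ q : ℚ, ∀ᵐ ω ∂ν, infOver f W'' ω < (q : ℝ) →
      infOver f (closure (⋃ q, W q)) ω < (q : ℝ) := by
    intro q
    have hsub : {ω | infOver f (closure (⋃ q, W q)) ω < (q : ℝ)} ⊆
        {ω | infOver f W'' ω < (q : ℝ)} := fun ω hω => (infOver_anti f hUW ω).trans_lt hω
    have hnull : NullMeasurableSet {ω | infOver f (closure (⋃ q, W q)) ω < (q : ℝ)} ν :=
      (nullMeasurableSet_lt (hf.aemeasurable_infOver hU isClosed_closure hB)
        aemeasurable_const).mono_ac (toFinite_absolutelyContinuous _)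
    have hle : ν {ω | infOver f W'' ω < (q : ℝ)} ≤
        ν {ω | infOver f (closure (⋃ q, W q)) ω < (q : ℝ)} :=
      (hWmax q W'' hW'').trans (measure_mono fun ω hω =>
        (infOver_anti f ((subset_iUnion W q).trans subset_closure) ω).trans_lt hω)
    exact (ae_eq_of_subset_of_measure_ge hsub hle hnull (measure_ne_top _ _)).symm.le
  have hae' : ∀ᵐ ω ∂ν, infOver f (closure (⋃ q, W q)) ω ≤ infOver f W' ω := by
    filter_upwards [ae_all_iff.2 hae] with ω hω
    refine le_trans ?_ (infOver_anti f (subset_union_right.trans subset_closure) ω :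
      infOver f W'' ω ≤ _)
    by_contra! hlt
    obtain ⟨q, hq, hq'⟩ := EReal.lt_iff_exists_rat_btwn.1 hlt
    exact lt_asymm (hω q hq) hq'
  exact (absolutelyContinuous_toFinite _).ae_le hae'

/-- On atoms of infinite measure, a superposition of finite upper integral is nonpositive. -/
theorem ae_comp_nonpos_of_infinite_atom [MeasurableSpace M] [BorelSpace M]
    (hf : IntSeparablyMeasurable μ f) {u : Ω → M}
    (hu : IntStronglyMeasurable μ u) {T : Set Ω} (hT : IsMeasureAtom μ T) (hTi : μ T = ∞)
    (hi : ∫⁻ ω in T, (f ω (u ω)).toENNReal ∂μ ≠ ∞) :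
    ∀ᵐ ω ∂μ.restrict T, f ω (u ω) ≤ 0 := by
  have hm := hf.aemeasurable_comp hu (IsTestSet.mem_atomSigmaRing (.inl hT))
  filter_upwards [hT.ae_eq_zero hTi hm.ereal_toENNReal hi] with ω hω
  exact EReal.toENNReal_eq_zero_iff.1 hω

/-- On every member of the `σ`-ring, some closed separable set attains the essential infimum. -/
theorem exists_isSeparable_forall_infOver_le [CompleteSpace M] [MeasurableSpace M] [BorelSpace M]
    (hatom : ∀ A, IsMeasureAtom μ A → μ A = ∞ → ∀ W : Set M, IsSeparable W →
      ∀ᵐ ω ∂μ.restrict A, 0 ≤ infOver f W ω)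
    (hf : IntSeparablyMeasurable μ f) {u : Ω → M}
    (hu : IntStronglyMeasurable μ u) {A : Set Ω} (hA : A ∈ atomSigmaRing μ)
    (hi : ∫⁻ ω in A, (f ω (u ω)).toENNReal ∂μ ≠ ∞) :
    ∃ W : Set M, IsSeparable W ∧ IsClosed W ∧ u '' A ⊆ W ∧
      AEMeasurable (infOver f W) (μ.restrict A) ∧
      ∀ W' : Set M, IsSeparable W' → ∀ᵐ ω ∂μ.restrict A, infOver f W ω ≤ infOver f W' ω := by
  obtain ⟨B, hBA, hB, hp⟩ := exists_sigmaFinite_part hA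
  obtain ⟨V, hV, hVmin⟩ := hf.exists_isSeparable_forall_infOver_le_of_sigmaFinite hB
  have huA := hu.isSeparable_image hA
  let W := closure (V ∪ u '' A)
  have hW : IsSeparable W := (hV.union huA).closure
  have huW : u '' A ⊆ W := subset_union_right.trans subset_closure
  have hle : ∀ T ⊆ A, IsMeasureAtom μ T → μ T = ∞ → ∀ᵐ ω ∂μ.restrict T, infOver f W ω ≤ 0 := by
    intro T hTA hT hTi
    filter_upwards [ae_comp_nonpos_of_infinite_atom hf hu hT hTi
      (ne_top_of_le_ne_top hi (lintegral_mono_set hTA)), ae_restrict_mem hT.1] with ω h1 h2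
    exact (infOver_le f (huW (mem_image_of_mem u (hTA h2))) ω).trans h1
  refine ⟨W, hW, isClosed_closure, huW, ?_, fun W' hW' => ?_⟩
  · refine aemeasurable_restrict_of_forall_testSet hA fun T hTA hT => ?_
    rcases hT.infinite_atom_or_sigmaFinite with h | h
    · refine aemeasurable_const (b := (0 : EReal)) |>.congr ?_
      filter_upwards [hle T hTA h.1 h.2, hatom T h.1 h.2 W hW] with ω h1 h2 using le_antisymm h2 h1
    · exact hf.aemeasurable_infOver hW isClosed_closure h
  · have hB' : ∀ᵐ ω ∂μ.restrict A, ω ∈ B → infOver f V ω ≤ infOver f W' ω :=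
      ae_restrict_of_ae ((ae_restrict_iff' hB.1).1 (hVmin W' hW'))
    filter_upwards [hp (fun ω => infOver f W ω ≤ infOver f W' ω) fun T hTA hT hTi => by
      filter_upwards [hle T hTA hT hTi, hatom T hT hTi W' hW'] with ω h1 h2 using h1.trans h2,
      hB'] with ω h1 h2
    by_cases hω : ω ∈ B
    · exact (infOver_anti f (subset_union_left.trans subset_closure) ω).trans (h2 hω)
    · exact h1 hω

/-- If a separable set attains the essential infimum on `A`, then the essential infimum function
is the infimum over this set. -/
theorem isEssInfOn_iff_ae_eq_infOver {A : Set Ω} {W : Set M} (hW : IsSeparable W)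
    (hm : AEMeasurable (infOver f W) (μ.restrict A))
    (hmin : ∀ W' : Set M, IsSeparable W' → ∀ᵐ ω ∂μ.restrict A, infOver f W ω ≤ infOver f W' ω)
    {m : Ω → EReal} :
    IsEssInfOn μ A (infFamily f) m ↔ ∀ᵐ ω ∂μ.restrict A, m ω = infOver f W ω := by
  constructor
  · rintro ⟨-, h2, h3⟩
    filter_upwards [h2 ⟨W, hW⟩, h3 _ hm fun W' => hmin W'.1 W'.2] with ω h h'
      using le_antisymm h h'
  · intro h
    refine ⟨hm.congr (h.mono fun ω hω => hω.symm), fun W' => ?_, fun n _ hn => ?_⟩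
    · filter_upwards [h, hmin W'.1 W'.2] with ω h1 h2 using h1.trans_le h2
    · filter_upwards [h, hn ⟨W, hW⟩] with ω h1 h2 using h2.trans_eq h1.symm

end Infimum

section Gap

/-- The amount `v⁻ + (a⁺ - v⁺)` by which `v` lies below the positive part of `a`. -/
noncomputable def gap (a v : EReal) : ℝ≥0∞ := (-v).toENNReal + (a.toENNReal - v.toENNReal)

theorem gap_antitone (a : EReal) : Antitone (gap a) := fun _ _ h =>
  add_le_add (EReal.toENNReal_le_toENNReal (EReal.neg_le_neg_iff.2 h))
    (tsub_le_tsub_left (EReal.toENNReal_le_toENNReal h) _)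

theorem gap_top (a : EReal) : gap a ⊤ = 0 := by simp [gap]

theorem continuous_gap {a : EReal} (ha : a ≠ ⊤) : Continuous (gap a) :=
  (EReal.continuous_toENNReal.comp continuous_neg).add
    ((ENNReal.continuous_sub_left (EReal.toENNReal_ne_top_iff.2 ha)).comp
      EReal.continuous_toENNReal)

theorem measurable_gap : Measurable fun p : EReal × EReal => gap p.1 p.2 :=
  (measurable_ereal_toENNReal.comp measurable_snd.neg).add
    ((measurable_ereal_toENNReal.comp measurable_fst).sub
      (measurable_ereal_toENNReal.comp measurable_snd))

theorem toENNReal_le_of_gap_pos {a v : EReal} (h : 0 < gap a v) :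
    v.toENNReal ≤ a.toENNReal := by
  by_contra! hlt
  have h1 : 0 < v := EReal.toENNReal_pos_iff.1 (zero_le.trans_lt hlt)
  have h2 : (-v).toENNReal = 0 := EReal.toENNReal_of_nonpos (by simpa using h1.le)
  rw [gap, h2, tsub_eq_zero_of_le hlt.le] at h
  simp at h

theorem gap_add_toENNReal {a v : EReal} (h : v.toENNReal ≤ a.toENNReal) :
    gap a v + v.toENNReal = (-v).toENNReal + a.toENNReal := by
  rw [gap, add_assoc, tsub_add_cancel_of_le h]

theorem gap_infOver {Ω M : Type*} (f : Ω → M → EReal) (W : Set M) (ω : Ω) {a : EReal}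
    (ha : a ≠ ⊤) : gap a (infOver f W ω) = ⨆ x : W, gap a (f ω x) := by
  rw [infOver, iInf_subtype']
  exact (gap_antitone a).map_iInf_of_continuousAt (continuous_gap ha).continuousAt (gap_top a)

theorem lintegral_gap_add {Ω : Type*} [MeasurableSpace Ω] {ν : Measure Ω} {a v : Ω → EReal}
    (ha : AEMeasurable a ν) (hv : AEMeasurable v ν)
    (h : ∀ᵐ ω ∂ν, (v ω).toENNReal ≤ (a ω).toENNReal) :
    ∫⁻ ω, gap (a ω) (v ω) ∂ν + ∫⁻ ω, (v ω).toENNReal ∂ν =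
      ∫⁻ ω, (-v ω).toENNReal ∂ν + ∫⁻ ω, (a ω).toENNReal ∂ν := by
  rw [← lintegral_add_right' _ hv.ereal_toENNReal, ← lintegral_add_right' _ ha.ereal_toENNReal]
  exact lintegral_congr_ae (h.mono fun ω hω => gap_add_toENNReal hω)

theorem coe_sub_coe_le {p q x y : ℝ≥0∞} (hp : p ≠ ∞) (hq : q ≠ ∞) (h : p + x ≤ q + y) :
    (p : EReal) - y ≤ q - x := by
  rcases eq_or_ne y ∞ with rfl | hy
  · lift p to ℝ≥0 using hp
    simp [EReal.sub_top]
  have hx : x ≠ ∞ := fun hx => by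
    simp [hx, hq, hy] at h
  lift p to ℝ≥0 using hp
  lift q to ℝ≥0 using hq
  lift x to ℝ≥0 using hx
  lift y to ℝ≥0 using hy
  norm_cast at h
  have h' : (p : ℝ) + x ≤ q + y := by exact_mod_cast h
  have : ((p : ℝ) : EReal) - (y : ℝ) ≤ (q : ℝ) - (x : ℝ) := by
    norm_cast
    linarith
  exact this

theorem le_coe_sub_of_forall_lt {c : EReal} {p J : ℝ≥0∞} (hp : p ≠ ∞) (h0 : c ≤ p)
    (h : ∀ L < J, c ≤ p - (L : EReal)) : c ≤ p - (J : EReal) := by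
  by_contra! hlt
  obtain ⟨r, hr, hrc⟩ := EReal.lt_iff_exists_real_btwn.1 hlt
  lift p to ℝ≥0 using hp
  have hrp : r < p :=
    EReal.coe_lt_coe_iff.1 (show (r : EReal) < ((p : ℝ) : EReal) from hrc.trans_le h0)
  have hL : ENNReal.ofReal (p - r) < J := by
    rcases eq_or_ne J ∞ with rfl | hJ
    · exact ENNReal.ofReal_lt_top
    lift J to ℝ≥0 using hJ
    have hr' : (((p : ℝ) - (J : ℝ) : ℝ) : EReal) < r := hr
    rw [EReal.coe_lt_coe_iff] at hr'
    rw [ENNReal.ofReal_lt_coe_iff (by linarith)]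
    linarith
  have := h _ hL
  rw [EReal.coe_ennreal_ofReal, max_eq_left (by linarith)] at this
  have h2 : c ≤ (((p : ℝ) - ((p : ℝ) - r) : ℝ) : EReal) := this
  rw [sub_sub_cancel] at h2
  exact lt_irrefl _ (hrc.trans_le h2)

end Gap

section ExhIntegral

variable {Ω : Type*} [MeasurableSpace Ω] {μ : Measure Ω}

theorem exhIntegralFamily_of_ne_top {α : Set Ω → Ω → EReal}
    (h : (⨆ A ∈ atomSigmaRing μ, ∫⁻ ω in A, (α A ω).toENNReal ∂μ) ≠ ∞) :
    exhIntegralFamily μ α =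
      ((⨆ A ∈ atomSigmaRing μ, ∫⁻ ω in A, (α A ω).toENNReal ∂μ : ℝ≥0∞) : EReal) -
        ((⨆ A ∈ atomSigmaRing μ, ∫⁻ ω in A, (-α A ω).toENNReal ∂μ : ℝ≥0∞) : EReal) :=
  if_neg h

theorem exhIntegralFamily_ne_top_iff {α : Set Ω → Ω → EReal} :
    exhIntegralFamily μ α ≠ ⊤ ↔
      (⨆ A ∈ atomSigmaRing μ, ∫⁻ ω in A, (α A ω).toENNReal ∂μ) ≠ ∞ := by
  refine ⟨fun h h' => h (if_pos h'), fun h => ?_⟩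
  rw [exhIntegralFamily_of_ne_top h]
  refine ne_top_of_le_ne_top (EReal.coe_ennreal_eq_top_iff.not.2 h) ?_
  have := coe_sub_coe_le h h (x := 0) (y := ⨆ A ∈ atomSigmaRing μ, ∫⁻ ω in A, (-α A ω).toENNReal ∂μ)
    (by simp)
  simpa using this

theorem exhIntegralFamily_mono {α β : Set Ω → Ω → EReal}
    (h : ∀ A ∈ atomSigmaRing μ, ∀ᵐ ω ∂μ.restrict A, α A ω ≤ β A ω) :
    exhIntegralFamily μ α ≤ exhIntegralFamily μ β := by
  by_cases hβ : (⨆ A ∈ atomSigmaRing μ, ∫⁻ ω in A, (β A ω).toENNReal ∂μ) = ∞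
  · exact le_top.trans_eq (if_pos hβ).symm
  have hP : (⨆ A ∈ atomSigmaRing μ, ∫⁻ ω in A, (α A ω).toENNReal ∂μ) ≤
      ⨆ A ∈ atomSigmaRing μ, ∫⁻ ω in A, (β A ω).toENNReal ∂μ :=
    iSup₂_mono fun A hA => lintegral_mono_ae <|
      (h A hA).mono fun ω hω => EReal.toENNReal_le_toENNReal hω
  have hN : (⨆ A ∈ atomSigmaRing μ, ∫⁻ ω in A, (-β A ω).toENNReal ∂μ) ≤
      ⨆ A ∈ atomSigmaRing μ, ∫⁻ ω in A, (-α A ω).toENNReal ∂μ :=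
    iSup₂_mono fun A hA => lintegral_mono_ae <|
      (h A hA).mono fun ω hω => EReal.toENNReal_le_toENNReal (EReal.neg_le_neg_iff.2 hω)
  have hα := ne_top_of_le_ne_top hβ hP
  rw [exhIntegralFamily_of_ne_top hα, exhIntegralFamily_of_ne_top hβ]
  exact coe_sub_coe_le hα hβ (add_le_add hP hN)

theorem exhIntegralFamily_congr {α β : Set Ω → Ω → EReal}
    (h : ∀ A ∈ atomSigmaRing μ, ∀ᵐ ω ∂μ.restrict A, α A ω = β A ω) :
    exhIntegralFamily μ α = exhIntegralFamily μ β :=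
  le_antisymm (exhIntegralFamily_mono fun A hA => (h A hA).mono fun _ hω => hω.le)
    (exhIntegralFamily_mono fun A hA => (h A hA).mono fun _ hω => hω.ge)

/-- The integrals of a nonnegative function over the members of the `σ`-ring attain their
supremum on a member containing a given one. -/
theorem exists_superset_iSup_eq (φ : Ω → ℝ≥0∞) {A₀ : Set Ω} (hA₀ : A₀ ∈ atomSigmaRing μ) :
    ∃ A ∈ atomSigmaRing μ, A₀ ⊆ A ∧ ∀ A' ∈ atomSigmaRing μ, A ⊆ A' →
      (⨆ A ∈ atomSigmaRing μ, ∫⁻ ω in A, φ ω ∂μ) = ∫⁻ ω in A', φ ω ∂μ := by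
  obtain ⟨A, hA, hA₀A, hmax⟩ := exists_superset_forall_le (μ := μ)
    (Φ := fun A => ∫⁻ ω in A, φ ω ∂μ) (fun _ _ _ _ h => lintegral_mono_set h) hA₀
  refine ⟨A, hA, hA₀A, fun A' hA' hAA' => le_antisymm (iSup₂_le fun B hB =>
    (hmax B hB).trans (lintegral_mono_set hAA')) (le_iSup₂_of_le A' hA' le_rfl)⟩

/-- If the integral of `φ` over `A` is finite and not increased by passing to a larger set, then
`φ` vanishes almost everywhere on the difference. -/
theorem ae_eq_zero_of_setLIntegral_le {φ : Ω → ℝ≥0∞} {A B : Set Ω} (hA : MeasurableSet A)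
    (hB : MeasurableSet B) (hφ : AEMeasurable φ (μ.restrict B))
    (hfin : ∫⁻ ω in A, φ ω ∂μ ≠ ∞) (hle : ∫⁻ ω in B ∪ A, φ ω ∂μ ≤ ∫⁻ ω in A, φ ω ∂μ) :
    ∀ᵐ ω ∂μ.restrict B, ω ∉ A → φ ω = 0 := by
  have h1 : ∫⁻ ω in B \ A, φ ω ∂μ + ∫⁻ ω in A, φ ω ∂μ ≤ 0 + ∫⁻ ω in A, φ ω ∂μ := by
    rw [zero_add, ← lintegral_union hA disjoint_sdiff_left, sdiff_union_self]
    exact hle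
  have h2 : ∫⁻ ω in B \ A, φ ω ∂μ = 0 :=
    le_antisymm ((ENNReal.add_le_add_iff_right hfin).1 h1) zero_le
  rw [lintegral_eq_zero_iff' (hφ.mono_measure (Measure.restrict_mono_set μ sdiff_subset))] at h2
  rw [Filter.EventuallyEq, ae_restrict_iff' (hB.diff hA)] at h2
  rw [ae_restrict_iff' hB]
  filter_upwards [h2] with ω h hω hωA using h ⟨hω, hωA⟩

end ExhIntegral

section Approximation

variable {Ω M : Type*} [MeasurableSpace Ω] {μ : Measure Ω} [MetricSpace M]

/-- A bounded strongly measurable selection, up to a set of small measure. -/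
theorem exists_bounded_selection [Nonempty M] [CompleteSpace M] [MeasurableSpace M] [BorelSpace M]
    {F : Set Ω} (hF : MeasurableSet F) (hFfin : μ F < ∞) {W : Set M} (hW : IsSeparable W)
    (hWc : IsClosed W) {Q : Ω → M → Prop} (hQ : MeasurableSet {p : F × W | Q p.1 p.2})
    (hex : ∀ᵐ ω ∂μ.restrict F, ∃ x ∈ W, Q ω x) {δ : ℝ≥0∞} (hδ : 0 < δ) :
    ∃ E ⊆ F, MeasurableSet E ∧ μ (F \ E) < δ ∧ ∃ u : Ω → M,
      StronglyMeasurable (fun ω : E => u ω) ∧ Bornology.IsBounded (u '' E) ∧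
        ∀ ω ∈ E, Q ω (u ω) := by
  classical
  obtain ⟨x₀⟩ := ‹Nonempty M›
  rcases eq_or_ne (μ F) 0 with h0 | h0
  · refine ⟨∅, empty_subset _, .empty, by simpa [h0] using hδ, fun _ => x₀,
      stronglyMeasurable_const, by simp, by simp⟩
  have : SeparableSpace W := hW.separableSpace
  have : CompleteSpace W := hWc.completeSpace_coe
  have : IsFiniteMeasure (μ.restrict F) := ⟨by simpa using hFfin⟩
  have hG := measurableSet_image_prodMap_val hF hQ
  have hproj : μ F ≤ μ.restrict F (Prod.fst '' (Prod.map Subtype.val id ''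
      {p : F × W | Q p.1 p.2} : Set (Ω × W))) := by
    rw [← Measure.restrict_apply_univ F]
    refine measure_mono_ae ?_
    filter_upwards [hex, ae_restrict_mem hF] with ω ⟨x, hx, hxQ⟩ hω _
    exact ⟨_, ⟨(⟨ω, hω⟩, ⟨x, hx⟩), hxQ, rfl⟩, rfl⟩
  obtain ⟨c, hc, hcF⟩ := exists_between (ENNReal.sub_lt_self hFfin.ne h0 hδ.ne')
  obtain ⟨F₁, hF₁, hcF₁, u, hu, huG⟩ :=
    exists_measurable_selection (μ.restrict F) hG (hcF.trans_le hproj)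
  have huQ : ∀ ω : F₁, (ω : Ω) ∈ F ∧ Q ω (u ω) := by
    intro ω
    obtain ⟨⟨ω', x⟩, hx, he⟩ := huG ω
    simp only [Prod.map_apply, id, Prod.mk.injEq] at he
    obtain ⟨h1, h2⟩ := he
    rw [← h1, ← h2]
    exact ⟨ω'.2, hx⟩
  have hF₁F : F₁ ⊆ F := fun ω hω => (huQ ⟨ω, hω⟩).1
  let E : ℕ → Set Ω := fun n => Subtype.val '' {ω : F₁ | dist (u ω : M) x₀ ≤ n}
  have hEm : ∀ n, MeasurableSet (E n) := fun n =>
    hF₁.subtype_image (measurableSet_le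
      ((continuous_subtype_val.dist continuous_const).measurable.comp hu) measurable_const)
  have hEF : ∀ n, E n ⊆ F₁ := fun n => by rintro _ ⟨ω, -, rfl⟩; exact ω.2
  have hEmono : Monotone E := fun a b hab => image_mono fun ω (hω : _ ≤ (a : ℝ)) =>
    show _ ≤ (b : ℝ) from hω.trans (by exact_mod_cast hab)
  have hEU : F₁ = ⋃ n, E n := by
    refine Subset.antisymm (fun ω hω => ?_) (iUnion_subset hEF)
    obtain ⟨n, hn⟩ := exists_nat_ge (dist (u ⟨ω, hω⟩ : M) x₀)
    exact mem_iUnion.2 ⟨n, ⟨ω, hω⟩, hn, rfl⟩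
  have hlt : μ F - δ < μ F₁ := by
    rw [Measure.restrict_apply hF₁, inter_eq_left.2 hF₁F] at hcF₁
    exact hc.trans_le hcF₁
  rw [hEU, hEmono.measure_iUnion, lt_iSup_iff] at hlt
  obtain ⟨n, hn⟩ := hlt
  have hE : E n ⊆ F := (hEF n).trans hF₁F
  refine ⟨E n, hE, hEm n, ?_, fun ω => if h : ω ∈ F₁ then u ⟨ω, h⟩ else x₀, ?_, ?_, ?_⟩
  · rw [measure_sdiff hE (hEm n).nullMeasurableSet ((measure_mono hE).trans_lt hFfin).ne]
    have hlt : μ F < μ (E n) + δ := by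
      by_contra! hle
      exact absurd hn (not_lt.2 (ENNReal.le_sub_of_add_le_right
        (ne_top_of_le_ne_top hFfin.ne (le_add_self.trans hle)) hle))
    exact ENNReal.sub_lt_of_lt_add (measure_mono hE) (by rwa [add_comm])
  · have h1 : StronglyMeasurable fun ω : E n => (u ⟨ω, hEF n ω.2⟩ : M) :=
      continuous_subtype_val.comp_stronglyMeasurable
        (hu.comp (measurable_subtype_coe.subtype_mk)).stronglyMeasurable
    convert h1 using 2 with ω
    exact dif_pos (hEF n ω.2)
  · refine Metric.isBounded_closedBall.subset (t := Metric.closedBall x₀ n) ?_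
    rintro _ ⟨_, ⟨ω, hω, rfl⟩, rfl⟩
    simp only [Subtype.coe_prop, dite_true, Metric.mem_closedBall]
    exact hω
  · rintro _ ⟨ω, -, rfl⟩
    simp only [Subtype.coe_prop, dite_true]
    exact (huQ ω).2

/-- An integral over a `σ`-finite set is approximated from below by the integrals of simple
functions which are strictly smaller on their support, and this support has finite measure. -/
theorem exists_simpleFunc_lt {ν : Measure Ω} [SigmaFinite ν] {D : Ω → ℝ≥0∞} {L : ℝ≥0∞}
    (hL : L < ∫⁻ ω, D ω ∂ν) :
    ∃ t : SimpleFunc Ω ℝ≥0, (∀ ω, t ω ≠ 0 → (t ω : ℝ≥0∞) < D ω) ∧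
      ν {ω | t ω ≠ 0} < ∞ ∧ ∫⁻ ω, t ω ∂ν ≠ ∞ ∧ L < ∫⁻ ω, t ω ∂ν := by
  simp_rw [lintegral_eq_nnreal, lt_iSup_iff] at hL
  obtain ⟨g, hgD, hg⟩ := hL
  rw [← SimpleFunc.lintegral_eq_lintegral] at hg
  obtain ⟨t, htg, htfin, ht⟩ := SimpleFunc.exists_lt_lintegral_simpleFunc_of_lt_lintegral
    (f := g) (by simpa using hg)
  have hI0 : ∫⁻ ω, t ω ∂ν ≠ 0 := (zero_le.trans_lt ht).ne'
  obtain ⟨c, hc, hc1⟩ := ENNReal.lt_iff_exists_nnreal_btwn.1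
    ((ENNReal.div_lt_iff (.inl hI0) (.inl htfin.ne)).2 (by rwa [one_mul]) :
      L / ∫⁻ ω, t ω ∂ν < 1)
  rw [ENNReal.div_lt_iff (.inl hI0) (.inl htfin.ne)] at hc
  have hcI : ∫⁻ ω, ((c • t) ω : ℝ≥0) ∂ν = c * ∫⁻ ω, t ω ∂ν := by
    rw [← lintegral_const_mul' _ _ ENNReal.coe_ne_top]
    exact lintegral_congr fun ω => by simp
  have hc1' : c < 1 := by exact_mod_cast hc1
  refine ⟨c • t, fun ω hω => ?_, ?_, ?_, hcI ▸ hc⟩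
  · have ht0 : t ω ≠ 0 := fun h => hω (by simp [h])
    refine lt_of_lt_of_le ?_ (hgD ω)
    refine lt_of_lt_of_le ?_ (ENNReal.coe_le_coe.2 (htg ω))
    rw [ENNReal.coe_lt_coe]
    have : (c • t) ω = c * t ω := rfl
    rw [this]
    exact mul_lt_of_lt_one_left (pos_iff_ne_zero.2 ht0) hc1'
  · have := SimpleFunc.measure_support_lt_top_of_lintegral_ne_top (μ := ν)
      (f := t.map ((↑) : ℝ≥0 → ℝ≥0∞)) (by
        rw [← SimpleFunc.lintegral_eq_lintegral]; simpa using htfin.ne)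
    refine (measure_mono fun ω hω => ?_).trans_lt this
    have ht0 : t ω ≠ 0 := fun h => hω (by simp [h])
    simpa using ht0
  · rw [hcI]
    exact ENNReal.mul_ne_top ENNReal.coe_ne_top htfin.ne

open Classical in
/-- By almost decomposability, the integral of the gap of the pointwise infimum is approximated
from below by the integrals of the gaps of members of `R`. -/
theorem AlmostDecomposable.exists_lt_setLIntegral_gap [CompleteSpace M] [MeasurableSpace M]
    [BorelSpace M] {R : Set (Ω → M)} (hdec : AlmostDecomposable μ R) {f : Ω → M → EReal}
    (hf : IntSeparablyMeasurable μ f) {u₀ : Ω → M} (hu₀R : u₀ ∈ R)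
    (hu₀ : IntStronglyMeasurable μ u₀) {B : Set Ω} (hB : IsSigmaFiniteSet μ B) {W : Set M}
    (hW : IsSeparable W) (hWc : IsClosed W) (hfin : ∀ᵐ ω ∂μ.restrict B, f ω (u₀ ω) ≠ ⊤)
    {L : ℝ≥0∞} (hL : L < ∫⁻ ω in B, gap (f ω (u₀ ω)) (infOver f W ω) ∂μ) :
    ∃ u ∈ R, (∀ ω, (f ω (u ω)).toENNReal ≤ (f ω (u₀ ω)).toENNReal) ∧
      L < ∫⁻ ω in B, gap (f ω (u₀ ω)) (f ω (u ω)) ∂μ := by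
  have := hB.2
  obtain ⟨t, htD, htsupp, htfin, htL⟩ := exists_simpleFunc_lt hL
  let F : Set Ω := {ω | t ω ≠ 0} ∩ B
  have hFm : MeasurableSet F :=
    (t.measurableSet_preimage {0}ᶜ : MeasurableSet {ω | t ω ≠ 0}).inter hB.1
  have hFfin : μ F < ∞ := by rwa [Measure.restrict_apply' hB.1] at htsupp
  have hFtest : IsTestSet μ F := .inr (isSigmaFiniteSet_of_measure_lt_top hFm hFfin)
  have hBF : ∫⁻ ω in B, t ω ∂μ = ∫⁻ ω in F, t ω ∂μ := by
    have h1 : ∫⁻ ω in B \ F, (t ω : ℝ≥0∞) ∂μ = 0 := by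
      refine (setLIntegral_congr_fun (hB.1.diff hFm) fun ω hω => ?_).trans lintegral_zero
      by_contra h
      exact hω.2 ⟨fun h0 => h (by simp [h0]), hω.1⟩
    rw [← lintegral_inter_add_sdiff _ B hFm, h1, add_zero,
      inter_eq_right.2 (inter_subset_right : F ⊆ B)]
  have hne : F.Nonempty := by
    by_contra h
    rw [not_nonempty_iff_eq_empty] at h
    simp [hBF, h] at htL
  have : Nonempty M := ⟨u₀ hne.some⟩
  have hε : ∫⁻ ω in B, t ω ∂μ - L ≠ 0 := (tsub_pos_of_lt htL).ne'
  obtain ⟨δ, hδ, hδt⟩ := exists_pos_setLIntegral_lt_of_measure_lt htfin hε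
  have hQ : MeasurableSet {p : F × W | (t p.1 : ℝ≥0∞) < gap (f p.1 (u₀ p.1)) (f p.1 p.2)} := by
    refine measurableSet_lt ?_ ?_
    · exact (t.measurable.comp (measurable_subtype_coe.comp measurable_fst)).coe_nnreal_ennreal
    · exact measurable_gap.comp (((hf.measurable_comp hu₀ hFtest).comp measurable_fst).prodMk
        (hf F hFtest W hW))
  obtain ⟨E, hEF, hEm, hEδ, u₁, hu₁, hu₁b, hu₁Q⟩ := exists_bounded_selection hFm hFfin hW hWc
    (Q := fun ω x => (t ω : ℝ≥0∞) < gap (f ω (u₀ ω)) (f ω x)) hQ (by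
      filter_upwards [ae_restrict_mem hFm,
        ae_mono (Measure.restrict_mono_set μ (inter_subset_right : F ⊆ B)) hfin] with ω hω hω'
      have := htD ω hω.1
      rw [gap_infOver f W ω hω', lt_iSup_iff] at this
      obtain ⟨x, hx⟩ := this
      exact ⟨x, x.2, hx⟩) (ENNReal.half_pos hδ.ne')
  obtain ⟨G, hGE, hGm, hGδ, hGR⟩ := hdec u₀ hu₀R E hEm ((measure_mono hEF).trans_lt hFfin) (δ / 2)
    (ENNReal.half_pos hδ.ne') u₁ hu₁ hu₁b
  have hGB : G ⊆ B := hGE.trans (hEF.trans inter_subset_right)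
  refine ⟨G.piecewise u₁ u₀, hGR, fun ω => ?_, ?_⟩
  · by_cases hω : ω ∈ G
    · rw [piecewise_eq_of_mem _ _ _ hω]
      exact toENNReal_le_of_gap_pos (zero_le.trans_lt (hu₁Q ω (hGE hω)))
    · rw [piecewise_eq_of_notMem _ _ _ hω]
  · have h1 : ∫⁻ ω in G, (t ω : ℝ≥0∞) ∂μ ≤
        ∫⁻ ω in B, gap (f ω (u₀ ω)) (f ω (G.piecewise u₁ u₀ ω)) ∂μ := by
      refine le_trans (setLIntegral_mono' hGm fun ω hω => ?_) (lintegral_mono_set hGB)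
      rw [piecewise_eq_of_mem _ _ _ hω]
      exact (hu₁Q ω (hGE hω)).le
    refine lt_of_lt_of_le ?_ h1
    have h2 : ∫⁻ ω in F \ G, (t ω : ℝ≥0∞) ∂μ < ∫⁻ ω in B, t ω ∂μ - L := by
      have h3 : μ.restrict B (F \ G) < δ := by
        refine (Measure.restrict_le_self _).trans_lt ?_
        have : F \ G ⊆ (F \ E) ∪ (E \ G) := fun ω hω => by
          by_cases h : ω ∈ E
          exacts [.inr ⟨h, hω.2⟩, .inl ⟨hω.1, h⟩]
        refine ((measure_mono this).trans (measure_union_le _ _)).trans_lt ?_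
        exact (ENNReal.add_lt_add hEδ hGδ).trans_eq (ENNReal.add_halves δ)
      have := hδt _ h3
      rwa [Measure.restrict_restrict (hFm.diff hGm), inter_eq_left.2
        (sdiff_subset.trans inter_subset_right : F \ G ⊆ B)] at this
    have h4 : ∫⁻ ω in B, t ω ∂μ = ∫⁻ ω in G, (t ω : ℝ≥0∞) ∂μ + ∫⁻ ω in F \ G, (t ω : ℝ≥0∞) ∂μ := by
      rw [hBF, ← lintegral_inter_add_sdiff _ F hGm, inter_eq_right.2 (hGE.trans hEF)]
    by_contra! hle
    rw [h4] at h2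
    have h5 := (add_le_add_left hle (∫⁻ ω in F \ G, (t ω : ℝ≥0∞) ∂μ))
    have h6 := tsub_le_iff_left.2 h5
    exact lt_irrefl _ (h2.trans_le h6)

end Approximation

section Interchange

theorem setLIntegral_comp_ne_top {Ω M : Type*} [MeasurableSpace Ω] {μ : Measure Ω}
    {f : Ω → M → EReal} {u : Ω → M} (hu : integralFunctional μ f u ≠ ⊤) {A : Set Ω}
    (hA : A ∈ atomSigmaRing μ) : ∫⁻ ω in A, (f ω (u ω)).toENNReal ∂μ ≠ ∞ :=
  ne_top_of_le_ne_top (exhIntegralFamily_ne_top_iff.1 hu)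
    (le_iSup₂_of_le (f := fun A (_ : A ∈ atomSigmaRing μ) =>
      ∫⁻ ω in A, (f ω (u ω)).toENNReal ∂μ) A hA le_rfl)

variable {Ω M : Type*} [MeasurableSpace Ω] {μ : Measure Ω} [MetricSpace M]
  {f : Ω → M → EReal}

theorem IsEssInfOn.ae_eq {ι : Type*} {v : ι → Ω → EReal} {A : Set Ω} {m n : Ω → EReal}
    (hm : IsEssInfOn μ A v m) (hn : IsEssInfOn μ A v n) : ∀ᵐ ω ∂μ.restrict A, m ω = n ω := by
  filter_upwards [hm.2.2 n hn.1 hn.2.1, hn.2.2 m hm.1 hm.2.1] with ω h1 h2 using le_antisymm h2 h1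

theorem IsEssInf.ae_eq {ι : Type*} {v : ι → Ω → EReal} {m n : Ω → EReal}
    (hm : IsEssInf μ v m) (hn : IsEssInf μ v n) : ∀ᵐ ω ∂μ, m ω = n ω := by
  filter_upwards [hm.2.2 n hn.1 hn.2.1, hn.2.2 m hm.1 hm.2.1] with ω h1 h2 using le_antisymm h2 h1

theorem IsEssInfOn.ae_le_comp {A : Set Ω} {m : Ω → EReal}
    (hm : IsEssInfOn μ A (infFamily f) m) (hA : A ∈ atomSigmaRing μ) {u : Ω → M}
    (hu : IntStronglyMeasurable μ u) : ∀ᵐ ω ∂μ.restrict A, m ω ≤ f ω (u ω) := by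
  filter_upwards [hm.2.1 ⟨u '' A, hu.isSeparable_image hA⟩,
    ae_restrict_mem (measurableSet_of_mem_atomSigmaRing hA)] with ω h1 h2
  exact h1.trans (infOver_le f (mem_image_of_mem u h2) ω)

variable [CompleteSpace M] [MeasurableSpace M] [BorelSpace M]

theorem IsEssInfOn.mono
    (hatom : ∀ A, IsMeasureAtom μ A → μ A = ∞ → ∀ W : Set M, IsSeparable W →
      ∀ᵐ ω ∂μ.restrict A, 0 ≤ infOver f W ω)
    (hf : IntSeparablyMeasurable μ f) {u : Ω → M} (hu : IntStronglyMeasurable μ u)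
    (hI : integralFunctional μ f u ≠ ⊤) {A A' : Set Ω} (hA' : A' ∈ atomSigmaRing μ)
    (hAA' : A ⊆ A') {m : Ω → EReal} (hm : IsEssInfOn μ A' (infFamily f) m) :
    IsEssInfOn μ A (infFamily f) m := by
  obtain ⟨W, hW, -, -, hWm, hWmin⟩ := exists_isSeparable_forall_infOver_le hatom hf hu hA'
    (setLIntegral_comp_ne_top hI hA')
  have hle := Measure.restrict_mono_set μ hAA'
  exact (isEssInfOn_iff_ae_eq_infOver hW (hWm.mono_measure hle)
    fun W' hW' => ae_mono hle (hWmin W' hW')).2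
    (ae_mono hle ((isEssInfOn_iff_ae_eq_infOver hW hWm hWmin).1 hm))

theorem monotoneOn_setLIntegral_essInf
    (hatom : ∀ A, IsMeasureAtom μ A → μ A = ∞ → ∀ W : Set M, IsSeparable W →
      ∀ᵐ ω ∂μ.restrict A, 0 ≤ infOver f W ω)
    (hf : IntSeparablyMeasurable μ f) {u : Ω → M} (hu : IntStronglyMeasurable μ u)
    (hI : integralFunctional μ f u ≠ ⊤) {m : Set Ω → Ω → EReal}
    (hm : ∀ A ∈ atomSigmaRing μ, IsEssInfOn μ A (infFamily f) (m A)) :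
    MonotoneOn (fun A => ∫⁻ ω in A, (-m A ω).toENNReal ∂μ) (atomSigmaRing μ) := by
  intro A hA A' hA' hAA'
  refine le_trans (lintegral_mono_ae ?_) (lintegral_mono_set hAA')
  filter_upwards [(hm A hA).ae_eq ((hm A' hA').mono hatom hf hu hI hA' hAA')] with ω hω
  rw [hω]

/-- The interchange of infimum and integral. -/
theorem iInf_integralFunctional_eq
    (hatom : ∀ A, IsMeasureAtom μ A → μ A = ∞ → ∀ W : Set M, IsSeparable W →
      ∀ᵐ ω ∂μ.restrict A, 0 ≤ infOver f W ω)
    (hf : IntSeparablyMeasurable μ f) {R : Set (Ω → M)}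
    (hR : ∀ u ∈ R, IntStronglyMeasurable μ u) (hdec : AlmostDecomposable μ R) {u₀ : Ω → M}
    (hu₀R : u₀ ∈ R) (hI : integralFunctional μ f u₀ ≠ ⊤) {m : Set Ω → Ω → EReal}
    (hm : ∀ A ∈ atomSigmaRing μ, IsEssInfOn μ A (infFamily f) (m A)) :
    (⨅ u ∈ R, integralFunctional μ f u) = exhIntegralFamily μ m := by
  have hu₀ := hR u₀ hu₀R
  refine le_antisymm ?_ (le_iInf₂ fun u hu => exhIntegralFamily_mono fun A hA =>
    (hm A hA).ae_le_comp hA (hR u hu))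
  have hP := exhIntegralFamily_ne_top_iff.1 hI
  obtain ⟨A₁, hA₁, -, hA₁P⟩ := exists_superset_iSup_eq (μ := μ)
    (fun ω => (f ω (u₀ ω)).toENNReal) atomSigmaRing_nonempty.some_mem
  obtain ⟨A, hA, hA₁A, hAN⟩ := exists_superset_forall_le
    (monotoneOn_setLIntegral_essInf hatom hf hu₀ hI hm) hA₁
  have hAm := measurableSet_of_mem_atomSigmaRing hA
  have hi := setLIntegral_comp_ne_top hI hA
  obtain ⟨W, hW, hWc, -, hWm, hWmin⟩ := exists_isSeparable_forall_infOver_le hatom hf hu₀ hA hi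
  have hmW := (isEssInfOn_iff_ae_eq_infOver hW hWm hWmin).1 (hm A hA)
  have hg := hf.aemeasurable_comp hu₀ hA
  set p := ∫⁻ ω in A, (f ω (u₀ ω)).toENNReal ∂μ with hp
  have hPp : (⨆ A ∈ atomSigmaRing μ, ∫⁻ ω in A, (f ω (u₀ ω)).toENNReal ∂μ) = p := hA₁P A hA hA₁A
  set J := ∫⁻ ω in A, gap (f ω (u₀ ω)) (infOver f W ω) ∂μ with hJ
  have hmu : ∀ A ∈ atomSigmaRing μ, ∀ᵐ ω ∂μ.restrict A, (m A ω).toENNReal ≤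
      (f ω (u₀ ω)).toENNReal := fun A hA =>
    ((hm A hA).ae_le_comp hA hu₀).mono fun ω hω => EReal.toENNReal_le_toENNReal hω
  have hPm : (⨆ A ∈ atomSigmaRing μ, ∫⁻ ω in A, (m A ω).toENNReal ∂μ) ≠ ∞ :=
    ne_top_of_le_ne_top hP (iSup₂_mono fun A hA => lintegral_mono_ae (hmu A hA))
  have hlower : (p : EReal) - J ≤ exhIntegralFamily μ m := by
    rw [exhIntegralFamily_of_ne_top hPm]
    refine coe_sub_coe_le hi hPm ?_
    have h1 := lintegral_gap_add hg (hm A hA).1 (hmu A hA)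
    have h2 : ∫⁻ ω in A, gap (f ω (u₀ ω)) (m A ω) ∂μ = J :=
      lintegral_congr_ae (hmW.mono fun ω hω => by simp only [hω])
    have h3 : (⨆ A ∈ atomSigmaRing μ, ∫⁻ ω in A, (-m A ω).toENNReal ∂μ) ≤
        ∫⁻ ω in A, (-m A ω).toENNReal ∂μ := iSup₂_le hAN
    have h4 : ∫⁻ ω in A, (m A ω).toENNReal ∂μ ≤
        ⨆ A ∈ atomSigmaRing μ, ∫⁻ ω in A, (m A ω).toENNReal ∂μ :=
      le_iSup₂_of_le (f := fun A (_ : A ∈ atomSigmaRing μ) =>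
        ∫⁻ ω in A, (m A ω).toENNReal ∂μ) A hA le_rfl
    rw [h2] at h1
    calc p + _ ≤ p + ∫⁻ ω in A, (-m A ω).toENNReal ∂μ := by gcongr
      _ = J + ∫⁻ ω in A, (m A ω).toENNReal ∂μ := by rw [h1, add_comm]
      _ ≤ _ := by rw [add_comm]; gcongr
  refine le_trans (le_coe_sub_of_forall_lt hi ?_ fun L hL => ?_) hlower
  · refine (iInf₂_le u₀ hu₀R).trans ?_
    have h1 : integralFunctional μ f u₀ = _ := exhIntegralFamily_of_ne_top hP
    rw [h1, hPp]
    have h2 := coe_sub_coe_le hi hi (x := 0)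
      (y := ⨆ A ∈ atomSigmaRing μ, ∫⁻ ω in A, (-f ω (u₀ ω)).toENNReal ∂μ) (by simp)
    simpa using h2
  obtain ⟨B, hBA, hB, hBp⟩ := exists_sigmaFinite_part hA
  have hJB : J = ∫⁻ ω in B, gap (f ω (u₀ ω)) (infOver f W ω) ∂μ := by
    have h1 := hBp (fun ω => gap (f ω (u₀ ω)) (infOver f W ω) = 0) fun T hTA hT hTi => by
      filter_upwards [hatom T hT hTi W hW, ae_comp_nonpos_of_infinite_atom hf hu₀ hT hTi
        (setLIntegral_comp_ne_top hI (IsTestSet.mem_atomSigmaRing (.inl hT)))] with ω h1 h2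
      rw [gap, EReal.toENNReal_of_nonpos h2, EReal.toENNReal_of_nonpos (by simpa using h1)]
      simp
    have h2 : ∫⁻ ω in A \ B, gap (f ω (u₀ ω)) (infOver f W ω) ∂μ = 0 := by
      refine (lintegral_congr_ae ?_).trans lintegral_zero
      filter_upwards [ae_mono (Measure.restrict_mono_set μ (sdiff_subset (s := A) (t := B))) h1,
        ae_restrict_mem (hAm.diff hB.1)] with ω h3 h4 using h3 h4.2
    rw [hJ, ← lintegral_inter_add_sdiff _ A hB.1, h2, add_zero, inter_eq_right.2 hBA]
  have hfin : ∀ᵐ ω ∂μ.restrict B, f ω (u₀ ω) ≠ ⊤ := by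
    filter_upwards [ae_mono (Measure.restrict_mono_set μ hBA)
      (ae_lt_top' hg.ereal_toENNReal hi)] with ω hω
    exact EReal.toENNReal_ne_top_iff.1 hω.ne
  obtain ⟨u, huR, hule, huL⟩ := hdec.exists_lt_setLIntegral_gap hf hu₀R hu₀ hB hW hWc hfin
    (hJB ▸ hL)
  refine (iInf₂_le u huR).trans ?_
  have hPu : (⨆ A ∈ atomSigmaRing μ, ∫⁻ ω in A, (f ω (u ω)).toENNReal ∂μ) ≠ ∞ :=
    ne_top_of_le_ne_top hP (iSup₂_mono fun A _ => lintegral_mono hule)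
  have h1 : integralFunctional μ f u = _ := exhIntegralFamily_of_ne_top hPu
  rw [h1]
  refine coe_sub_coe_le hPu hi ?_
  obtain ⟨A₂, hA₂, hAA₂, hA₂P⟩ := exists_superset_iSup_eq (fun ω => (f ω (u ω)).toENNReal) hA
  have h2 := lintegral_gap_add (hf.aemeasurable_comp hu₀ hA₂) (hf.aemeasurable_comp (hR u huR) hA₂)
    (ae_of_all _ hule)
  rw [← hA₁P A₂ hA₂ (hA₁A.trans hAA₂), hPp, ← hA₂P A₂ hA₂ subset_rfl] at h2
  have h3 : ∫⁻ ω in A₂, (-f ω (u ω)).toENNReal ∂μ ≤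
      ⨆ A ∈ atomSigmaRing μ, ∫⁻ ω in A, (-f ω (u ω)).toENNReal ∂μ :=
    le_iSup₂_of_le (f := fun A (_ : A ∈ atomSigmaRing μ) =>
      ∫⁻ ω in A, (-f ω (u ω)).toENNReal ∂μ) A₂ hA₂ le_rfl
  have h4 : L ≤ ∫⁻ ω in A₂, gap (f ω (u₀ ω)) (f ω (u ω)) ∂μ :=
    huL.le.trans (lintegral_mono_set (hBA.trans hAA₂))
  calc _ ≤ (⨆ A ∈ atomSigmaRing μ, ∫⁻ ω in A, (f ω (u ω)).toENNReal ∂μ) +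
        ∫⁻ ω in A₂, gap (f ω (u₀ ω)) (f ω (u ω)) ∂μ := by gcongr
    _ = ∫⁻ ω in A₂, (-f ω (u ω)).toENNReal ∂μ + p := by rw [← h2, add_comm]
    _ ≤ _ := by rw [add_comm]; gcongr

/-- If the negative parts of the essential infima have bounded integrals, then there is a member
`A` of the `σ`-ring outside of which the integrand is nonnegative and its superposition with `u`
vanishes. -/
theorem exists_mem_atomSigmaRing_core
    (hatom : ∀ A, IsMeasureAtom μ A → μ A = ∞ → ∀ W : Set M, IsSeparable W →
      ∀ᵐ ω ∂μ.restrict A, 0 ≤ infOver f W ω)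
    (hf : IntSeparablyMeasurable μ f) {u : Ω → M} (hu : IntStronglyMeasurable μ u)
    (hI : integralFunctional μ f u ≠ ⊤) {m : Set Ω → Ω → EReal}
    (hm : ∀ A ∈ atomSigmaRing μ, IsEssInfOn μ A (infFamily f) (m A))
    (hmb : exhIntegralFamily μ m ≠ ⊥) :
    ∃ A ∈ atomSigmaRing μ, ∀ B ∈ atomSigmaRing μ,
      (∀ᵐ ω ∂μ.restrict B, ω ∉ A → f ω (u ω) ≤ 0) ∧
      ∀ W : Set M, IsSeparable W → ∀ᵐ ω ∂μ.restrict B, ω ∉ A → 0 ≤ infOver f W ω := by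
  have hP := exhIntegralFamily_ne_top_iff.1 hI
  have hPm : (⨆ A ∈ atomSigmaRing μ, ∫⁻ ω in A, (m A ω).toENNReal ∂μ) ≠ ∞ :=
    ne_top_of_le_ne_top hP (iSup₂_mono fun A hA => lintegral_mono_ae
      (((hm A hA).ae_le_comp hA hu).mono fun ω hω => EReal.toENNReal_le_toENNReal hω))
  have hN : (⨆ A ∈ atomSigmaRing μ, ∫⁻ ω in A, (-m A ω).toENNReal ∂μ) ≠ ∞ := by
    intro h
    rw [exhIntegralFamily_of_ne_top hPm, h] at hmb
    lift (⨆ A ∈ atomSigmaRing μ, ∫⁻ ω in A, (m A ω).toENNReal ∂μ) to ℝ≥0 using hPm with q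
    exact hmb (by simp [EReal.sub_top])
  obtain ⟨A₁, hA₁, -, hA₁P⟩ := exists_superset_iSup_eq (μ := μ)
    (fun ω => (f ω (u ω)).toENNReal) atomSigmaRing_nonempty.some_mem
  obtain ⟨A, hA, hA₁A, hAN⟩ := exists_superset_forall_le
    (monotoneOn_setLIntegral_essInf hatom hf hu hI hm) hA₁
  have hAm := measurableSet_of_mem_atomSigmaRing hA
  refine ⟨A, hA, fun B hB => ?_⟩
  have hBm := measurableSet_of_mem_atomSigmaRing hB
  have hU := union_mem_atomSigmaRing hB hA
  constructor
  · filter_upwards [ae_eq_zero_of_setLIntegral_le hAm hBm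
      (hf.aemeasurable_comp hu hB).ereal_toENNReal (setLIntegral_comp_ne_top hI hA)
      ((hA₁P _ hU (hA₁A.trans subset_union_right)).symm.trans (hA₁P A hA hA₁A)).le] with ω h hω
    exact EReal.toENNReal_eq_zero_iff.1 (h hω)
  · intro W hW
    have hmU := hm _ hU
    have hmA := hmU.mono hatom hf hu hI hU (subset_union_right : A ⊆ B ∪ A)
    have hmB := hmU.mono hatom hf hu hI hU (subset_union_left : B ⊆ B ∪ A)
    have hAeq : ∫⁻ ω in A, (-m A ω).toENNReal ∂μ = ∫⁻ ω in A, (-m (B ∪ A) ω).toENNReal ∂μ :=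
      lintegral_congr_ae (((hm A hA).ae_eq hmA).mono fun ω hω => by simp only [hω])
    have hle := hAN _ hU
    simp only [hAeq] at hle
    filter_upwards [ae_eq_zero_of_setLIntegral_le (φ := fun ω => (-m (B ∪ A) ω).toENNReal) hAm hBm
      hmB.1.neg.ereal_toENNReal (hAeq ▸ ne_top_of_le_ne_top hN
        (le_iSup₂_of_le (f := fun A (_ : A ∈ atomSigmaRing μ) =>
          ∫⁻ ω in A, (-m A ω).toENNReal ∂μ) A hA le_rfl)) hle, hmB.2.1 ⟨W, hW⟩] with ω h1 h2 hω
    have h3 := EReal.toENNReal_eq_zero_iff.1 (h1 hω)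
    exact le_trans (by simpa using h3) h2

end Interchange

theorem eq_of_toENNReal_eq {a b : EReal} (h : a.toENNReal = b.toENNReal)
    (h' : (-a).toENNReal = (-b).toENNReal) : a = b := by
  rcases le_or_gt a 0 with ha | ha
  · have hb : b ≤ 0 := EReal.toENNReal_eq_zero_iff.1 (h ▸ EReal.toENNReal_of_nonpos ha)
    rw [← neg_inj]
    exact (EReal.toENNReal_eq_toENNReal (by simpa using ha) (by simpa using hb)).1 h'
  · have hb : 0 < b := EReal.toENNReal_pos_iff.1 (h ▸ EReal.toENNReal_pos_iff.2 ha)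
    exact (EReal.toENNReal_eq_toENNReal ha.le hb.le).1 h

theorem eq_and_eq_of_coe_sub_eq {p q x y : ℝ≥0∞} (hp : p ≠ ∞) (hqp : q ≤ p) (hxy : x ≤ y)
    (h : (p : EReal) - x = q - y) (hbot : (q : EReal) - y ≠ ⊥) : p = q ∧ x = y := by
  have hq := ne_top_of_le_ne_top hp hqp
  lift p to ℝ≥0 using hp
  lift q to ℝ≥0 using hq
  have hy : y ≠ ∞ := by
    rintro rfl
    exact hbot (by simp [EReal.sub_top])
  lift x to ℝ≥0 using ne_top_of_le_ne_top hy hxy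
  lift y to ℝ≥0 using hy
  have h1 : (((p : ℝ) - x : ℝ) : EReal) = ((q : ℝ) - y : ℝ) := h
  rw [EReal.coe_eq_coe_iff] at h1
  have h2 : (q : ℝ) ≤ p := by exact_mod_cast hqp
  have h3 : (x : ℝ) ≤ y := by exact_mod_cast hxy
  constructor
  · rw [ENNReal.coe_inj, ← NNReal.coe_inj]; linarith
  · rw [ENNReal.coe_inj, ← NNReal.coe_inj]; linarith

/-- Functions of the same finite exhausting integral, one of which is below the other, coincide
integrally almost everywhere. -/
theorem intAE_eq_of_exhIntegral_eq {Ω : Type*} [MeasurableSpace Ω] {μ : Measure Ω}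
    {m v : Ω → EReal} (hm : ∀ A ∈ atomSigmaRing μ, AEMeasurable m (μ.restrict A))
    (hv : ∀ A ∈ atomSigmaRing μ, AEMeasurable v (μ.restrict A))
    (hmv : ∀ A ∈ atomSigmaRing μ, ∀ᵐ ω ∂μ.restrict A, m ω ≤ v ω)
    (h : exhIntegral μ v = exhIntegral μ m) (htop : exhIntegral μ v ≠ ⊤)
    (hbot : exhIntegral μ m ≠ ⊥) : IntAE μ fun ω => v ω = m ω := by
  have hPle : ∀ A ∈ atomSigmaRing μ, ∀ᵐ ω ∂μ.restrict A, (m ω).toENNReal ≤ (v ω).toENNReal :=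
    fun A hA => (hmv A hA).mono fun ω hω => EReal.toENNReal_le_toENNReal hω
  have hNle : ∀ A ∈ atomSigmaRing μ, ∀ᵐ ω ∂μ.restrict A, (-v ω).toENNReal ≤ (-m ω).toENNReal :=
    fun A hA => (hmv A hA).mono fun ω hω =>
      EReal.toENNReal_le_toENNReal (EReal.neg_le_neg_iff.2 hω)
  have hPv := exhIntegralFamily_ne_top_iff.1 htop
  have hPm := exhIntegralFamily_ne_top_iff.1 (h ▸ htop : exhIntegral μ m ≠ ⊤)
  have e1 : exhIntegral μ v = _ := exhIntegralFamily_of_ne_top hPv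
  have e2 : exhIntegral μ m = _ := exhIntegralFamily_of_ne_top hPm
  rw [e1, e2] at h
  rw [e2] at hbot
  obtain ⟨hP, hN⟩ := eq_and_eq_of_coe_sub_eq hPv
    (iSup₂_mono fun A hA => lintegral_mono_ae (hPle A hA))
    (iSup₂_mono fun A hA => lintegral_mono_ae (hNle A hA)) h hbot
  have hNm : (⨆ A ∈ atomSigmaRing μ, ∫⁻ ω in A, (-m ω).toENNReal ∂μ) ≠ ∞ := by
    intro h
    rw [h] at hbot
    lift (⨆ A ∈ atomSigmaRing μ, ∫⁻ ω in A, (m ω).toENNReal ∂μ) to ℝ≥0 using hPm with q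
    exact hbot (by simp [EReal.sub_top])
  refine intAE_iff_forall_ae_restrict.2 fun T hT => ?_
  obtain ⟨A₁, hA₁, hTA₁, hA₁P⟩ := exists_superset_iSup_eq (fun ω => (m ω).toENNReal)
    hT.mem_atomSigmaRing
  obtain ⟨A, hA, hA₁A, hAN⟩ := exists_superset_iSup_eq (fun ω => (-v ω).toENNReal) hA₁
  have hAP := hA₁P A hA hA₁A
  have hAN := hAN A hA subset_rfl
  have h1 := ae_eq_of_ae_le_of_lintegral_le (hPle A hA) (hAP ▸ hPm) (hv A hA).ereal_toENNReal (by
    rw [← hAP, ← hP]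
    exact le_iSup₂_of_le (f := fun A (_ : A ∈ atomSigmaRing μ) =>
      ∫⁻ ω in A, (v ω).toENNReal ∂μ) A hA le_rfl)
  have h2 := ae_eq_of_ae_le_of_lintegral_le (hNle A hA) (hAN ▸ hN ▸ hNm)
    (hm A hA).neg.ereal_toENNReal (by
      rw [← hAN, hN]
      exact le_iSup₂_of_le (f := fun A (_ : A ∈ atomSigmaRing μ) =>
        ∫⁻ ω in A, (-m ω).toENNReal ∂μ) A hA le_rfl)
  filter_upwards [ae_mono (Measure.restrict_mono_set μ (hTA₁.trans hA₁A)) (h1.and h2)]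
    with ω hω using eq_of_toENNReal_eq hω.1.symm hω.2

section EssInf

variable {Ω M : Type*} [MeasurableSpace Ω] {μ : Measure Ω} [MetricSpace M]
  {f : Ω → M → EReal}

open Classical in
/-- The essential infimum on the whole space is glued from the one on `A` and the constant `0`. -/
theorem isEssInf_piecewise {u : Ω → M} (hu : IntStronglyMeasurable μ u) {A : Set Ω}
    (hA : A ∈ atomSigmaRing μ)
    (hnonpos : ∀ B ∈ atomSigmaRing μ, ∀ᵐ ω ∂μ.restrict B, ω ∉ A → f ω (u ω) ≤ 0)
    (hnonneg : ∀ B ∈ atomSigmaRing μ, ∀ W : Set M, IsSeparable W →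
      ∀ᵐ ω ∂μ.restrict B, ω ∉ A → 0 ≤ infOver f W ω)
    {m : Ω → EReal} (hm : IsEssInfOn μ A (infFamily f) m) :
    IsEssInf μ (infFamily f) (A.piecewise m fun _ => 0) := by
  have hAm := measurableSet_of_mem_atomSigmaRing hA
  have hmeas : AEMeasurable (A.piecewise m fun _ => 0) μ := by
    rw [← Measure.restrict_univ (μ := μ), ← union_compl_self A, aemeasurable_union_iff]
    refine ⟨hm.1.congr ?_, aemeasurable_const (b := (0 : EReal)) |>.congr ?_⟩
    · exact (piecewise_ae_eq_restrict hAm).symm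
    · exact (piecewise_ae_eq_restrict_compl hAm).symm
  have hglue : ∀ {p : Ω → Prop} {T : Set Ω}, (∀ᵐ ω ∂μ.restrict A, p ω) →
      (∀ᵐ ω ∂μ.restrict T, ω ∉ A → p ω) → ∀ᵐ ω ∂μ.restrict T, p ω := by
    intro p T h1 h2
    filter_upwards [ae_restrict_of_ae ((ae_restrict_iff' hAm).1 h1), h2] with ω h3 h4
    by_cases hω : ω ∈ A
    exacts [h3 hω, h4 hω]
  refine ⟨hmeas, fun W => ?_, fun n hn hnle => ?_⟩
  · refine intAE_iff_forall_ae_restrict.2 fun T hT => hglue ?_ ?_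
    · filter_upwards [hm.2.1 W, ae_restrict_mem hAm] with ω h1 h2
      rwa [piecewise_eq_of_mem _ _ _ h2]
    · filter_upwards [hnonneg T hT.mem_atomSigmaRing W.1 W.2] with ω h1 h2
      rw [piecewise_eq_of_notMem _ _ _ h2]
      exact h1 h2
  · have hnull : NullMeasurableSet {ω | ¬ n ω ≤ A.piecewise m (fun _ => 0) ω} μ :=
      (nullMeasurableSet_le hn hmeas).compl
    refine (intAE_iff_ae hnull).1 (intAE_iff_forall_ae_restrict.2 fun T hT => hglue ?_ ?_)
    · filter_upwards [hm.2.2 n hn.restrict fun W => (hnle W).ae_restrict hA,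
        ae_restrict_mem hAm] with ω h1 h2
      rwa [piecewise_eq_of_mem _ _ _ h2]
    · have hTA := hT.mem_atomSigmaRing
      filter_upwards [(hnle ⟨u '' T, hu.isSeparable_image hTA⟩).ae_restrict hTA,
        hnonpos T hTA, ae_restrict_mem hT.measurableSet] with ω h1 h2 h3 h4
      rw [piecewise_eq_of_notMem _ _ _ h4]
      exact (h1.trans (infOver_le f (mem_image_of_mem u h3) ω)).trans (h2 h4)

/-- An essential infimum on the whole space which is glued from the one on `A` and `0` is also an
essential infimum on every member of the `σ`-ring. -/
theorem IsEssInf.isEssInfOn [CompleteSpace M] [MeasurableSpace M] [BorelSpace M]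
    (hatom : ∀ A, IsMeasureAtom μ A → μ A = ∞ → ∀ W : Set M, IsSeparable W →
      ∀ᵐ ω ∂μ.restrict A, 0 ≤ infOver f W ω)
    (hf : IntSeparablyMeasurable μ f) {u : Ω → M} (hu : IntStronglyMeasurable μ u)
    (hI : integralFunctional μ f u ≠ ⊤) {A : Set Ω} (hA : A ∈ atomSigmaRing μ)
    (hnonpos : ∀ B ∈ atomSigmaRing μ, ∀ᵐ ω ∂μ.restrict B, ω ∉ A → f ω (u ω) ≤ 0)
    (hnonneg : ∀ B ∈ atomSigmaRing μ, ∀ W : Set M, IsSeparable W →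
      ∀ᵐ ω ∂μ.restrict B, ω ∉ A → 0 ≤ infOver f W ω)
    {m : Ω → EReal} (hm : IsEssInf μ (infFamily f) m) {B : Set Ω} (hB : B ∈ atomSigmaRing μ) :
    IsEssInfOn μ B (infFamily f) m ∧ ∀ᵐ ω ∂μ.restrict B, ω ∉ A → m ω = 0 := by
  classical
  have hAm := measurableSet_of_mem_atomSigmaRing hA
  have hBm := measurableSet_of_mem_atomSigmaRing hB
  obtain ⟨V, hV, -, -, hVm, hVmin⟩ := exists_isSeparable_forall_infOver_le hatom hf hu hA
    (setLIntegral_comp_ne_top hI hA)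
  obtain ⟨W, hW, -, huW, hWm, hWmin⟩ := exists_isSeparable_forall_infOver_le hatom hf hu hB
    (setLIntegral_comp_ne_top hI hB)
  have hVess := (isEssInfOn_iff_ae_eq_infOver hV hVm hVmin).2 (ae_of_all _ fun _ => rfl)
  have hmeq := ae_restrict_of_ae (s := B)
    (hm.ae_eq (isEssInf_piecewise hu hA hnonpos hnonneg hVess))
  refine ⟨(isEssInfOn_iff_ae_eq_infOver hW hWm hWmin).2 ?_, ?_⟩
  · filter_upwards [hmeq, ae_restrict_of_ae ((ae_restrict_iff' hAm).1 (hVmin W hW)),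
      hWmin V hV, hnonpos B hB, hnonneg B hB W hW, ae_restrict_mem hBm] with ω h1 h2 h3 h4 h5 h6
    rw [h1]
    by_cases hω : ω ∈ A
    · rw [piecewise_eq_of_mem _ _ _ hω]
      exact le_antisymm (h2 hω) h3
    · rw [piecewise_eq_of_notMem _ _ _ hω]
      exact le_antisymm (h5 hω) ((infOver_le f (huW (mem_image_of_mem u h6)) ω).trans (h4 hω))
  · filter_upwards [hmeq] with ω h1 hω
    rw [h1, piecewise_eq_of_notMem _ _ _ hω]

end EssInf

end InfInt

theorem theorem2p3 {Ω M : Type*} [MeasurableSpace Ω] (μ : Measure Ω)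
    [MetricSpace M] [CompleteSpace M] [MeasurableSpace M] [BorelSpace M]
    (R : Set (Ω → M)) (hR : ∀ u ∈ R, InfInt.IntStronglyMeasurable μ u)
    (hdec : InfInt.AlmostDecomposable μ R)
    (f : Ω → M → EReal) (hf : InfInt.IntSeparablyMeasurable μ f)
    (hatom : ∀ A, InfInt.IsMeasureAtom μ A → μ A = ∞ → ∀ W : Set M, IsSeparable W →
      ∀ᵐ ω ∂μ.restrict A, 0 ≤ InfInt.infOver f W ω)
    (hdom : ∃ u ∈ R, InfInt.integralFunctional μ f u ≠ ⊤) :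
    -- the essential infimum exists on every set of the `σ`-ring
    (∀ A ∈ InfInt.atomSigmaRing μ, ∃ m, InfInt.IsEssInfOn μ A (InfInt.infFamily f) m) ∧
    -- the interchange formula
    (∀ m : Set Ω → Ω → EReal,
      (∀ A ∈ InfInt.atomSigmaRing μ, InfInt.IsEssInfOn μ A (InfInt.infFamily f) (m A)) →
        (⨅ u ∈ R, InfInt.integralFunctional μ f u) = InfInt.exhIntegralFamily μ m) ∧
    ((⨅ u ∈ R, InfInt.integralFunctional μ f u) ≠ ⊥ →
      -- the essential infimum exists on the whole space
      (∃ m, InfInt.IsEssInf μ (InfInt.infFamily f) m) ∧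
      ∀ m, InfInt.IsEssInf μ (InfInt.infFamily f) m →
        -- it represents the common value
        (⨅ u ∈ R, InfInt.integralFunctional μ f u) = InfInt.exhIntegral μ m ∧
        -- it is attained by a separable set, on each set of the `σ`-ring ...
        (∀ A ∈ InfInt.atomSigmaRing μ, ∃ W : Set M, IsSeparable W ∧
          ∀ᵐ ω ∂μ.restrict A, m ω = InfInt.infOver f W ω) ∧
        -- ... and on the whole space if some `u ∈ R` with `I_f(u) < ∞` is separably valued
        ((∃ u ∈ R, InfInt.integralFunctional μ f u ≠ ⊤ ∧
            ∃ V : Set M, IsSeparable V ∧ InfInt.IntAE μ fun ω => u ω ∈ V) →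
          ∃ W : Set M, IsSeparable W ∧ InfInt.IntAE μ fun ω => m ω = InfInt.infOver f W ω) ∧
        -- pointwise characterization of minimizers
        ∀ u ∈ R,
          (IsMinOn (InfInt.integralFunctional μ f) R u ↔
            InfInt.IntAE μ fun ω => f ω (u ω) = m ω) ∧
          (AEMeasurable (fun ω => f ω (u ω)) μ →
            (IsMinOn (InfInt.integralFunctional μ f) R u ↔ ∀ᵐ ω ∂μ, f ω (u ω) = m ω))) := by
  classical
  obtain ⟨u₀, hu₀R, hI⟩ := hdom
  have hu₀ := hR u₀ hu₀R
  have hatt : ∀ A ∈ InfInt.atomSigmaRing μ, ∃ W : Set M, IsSeparable W ∧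
      ∀ m, InfInt.IsEssInfOn μ A (InfInt.infFamily f) m ↔
        ∀ᵐ ω ∂μ.restrict A, m ω = InfInt.infOver f W ω := fun A hA => by
    obtain ⟨W, hW, -, -, hWm, hWmin⟩ := InfInt.exists_isSeparable_forall_infOver_le hatom hf hu₀ hA
      (InfInt.setLIntegral_comp_ne_top hI hA)
    exact ⟨W, hW, fun m => InfInt.isEssInfOn_iff_ae_eq_infOver hW hWm hWmin⟩
  have hex : ∀ A ∈ InfInt.atomSigmaRing μ, ∃ m, InfInt.IsEssInfOn μ A (InfInt.infFamily f) m :=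
    fun A hA => by
      obtain ⟨W, -, h⟩ := hatt A hA
      exact ⟨InfInt.infOver f W, (h _).2 (ae_of_all _ fun _ => rfl)⟩
  have hformula := fun (m : Set Ω → Ω → EReal)
    (hm : ∀ A ∈ InfInt.atomSigmaRing μ, InfInt.IsEssInfOn μ A (InfInt.infFamily f) (m A)) =>
    InfInt.iInf_integralFunctional_eq hatom hf hR hdec hu₀R hI hm
  refine ⟨hex, hformula, fun hbot => ?_⟩
  choose! k hk using hex
  have hkbot : InfInt.exhIntegralFamily μ k ≠ ⊥ := hformula k hk ▸ hbot
  obtain ⟨A, hA, hcore⟩ := InfInt.exists_mem_atomSigmaRing_core hatom hf hu₀ hI hk hkbot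
  refine ⟨⟨_, InfInt.isEssInf_piecewise hu₀ hA (fun B hB => (hcore B hB).1)
    (fun B hB => (hcore B hB).2) (hk A hA)⟩, fun m hm => ?_⟩
  have hmOn : ∀ B ∈ InfInt.atomSigmaRing μ, InfInt.IsEssInfOn μ B (InfInt.infFamily f) m :=
    fun B hB => (hm.isEssInfOn hatom hf hu₀ hI hA (fun B hB => (hcore B hB).1)
      (fun B hB => (hcore B hB).2) hB).1
  have hval : (⨅ u ∈ R, InfInt.integralFunctional μ f u) = InfInt.exhIntegral μ m :=
    hformula (fun _ => m) hmOn
  have hmin : ∀ u ∈ R, IsMinOn (InfInt.integralFunctional μ f) R u ↔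
      InfInt.IntAE μ fun ω => f ω (u ω) = m ω := by
    intro u huR
    have hiff : IsMinOn (InfInt.integralFunctional μ f) R u ↔
        InfInt.exhIntegral μ (fun ω => f ω (u ω)) = InfInt.exhIntegral μ m := by
      rw [← hval]
      refine ⟨fun h => le_antisymm (le_iInf₂ fun v hv => h hv) (iInf₂_le u huR), fun h v hv => ?_⟩
      exact h.le.trans (iInf₂_le v hv)
    rw [hiff]
    refine ⟨fun h => ?_, fun h => InfInt.exhIntegralFamily_congr fun B hB => h.ae_restrict hB⟩
    refine InfInt.intAE_eq_of_exhIntegral_eq (fun B hB => (hmOn B hB).1)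
      (fun B hB => hf.aemeasurable_comp (hR u huR) hB)
      (fun B hB => (hmOn B hB).ae_le_comp hB (hR u huR)) h ?_ (hval ▸ hbot)
    rw [h, ← hval]
    exact ne_top_of_le_ne_top hI (iInf₂_le u₀ hu₀R)
  refine ⟨hval, fun B hB => ?_, ?_, fun u huR => ⟨hmin u huR, fun hmeas => ?_⟩⟩
  · obtain ⟨W, hW, h⟩ := hatt B hB
    exact ⟨W, hW, (h m).1 (hmOn B hB)⟩
  · rintro ⟨u, huR, huI, V, hV, huV⟩
    have hu := hR u huR
    obtain ⟨D, hD, hDcore⟩ := InfInt.exists_mem_atomSigmaRing_core hatom hf hu huI hk hkbot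
    obtain ⟨W, hW, h⟩ := hatt D hD
    have hmW := (h m).1 (hmOn D hD)
    refine ⟨W ∪ V, hW.union hV, InfInt.intAE_iff_forall_ae_restrict.2 fun T hT => ?_⟩
    have hTD := hT.mem_atomSigmaRing
    have hDm := InfInt.measurableSet_of_mem_atomSigmaRing hD
    filter_upwards [ae_restrict_of_ae ((ae_restrict_iff' hDm).1 hmW),
      (hmOn T hTD).2.1 ⟨W ∪ V, hW.union hV⟩, huV.ae_restrict hTD, (hDcore T hTD).1,
      (hm.isEssInfOn hatom hf hu huI hD (fun B hB => (hDcore B hB).1)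
        (fun B hB => (hDcore B hB).2) hTD).2] with ω h1 h2 h3 h4 h5
    refine le_antisymm h2 ?_
    by_cases hω : ω ∈ D
    · rw [h1 hω]
      exact InfInt.infOver_anti f subset_union_left ω
    · rw [h5 hω]
      exact (InfInt.infOver_le f (subset_union_right h3) ω).trans (h4 hω)
  · rw [hmin u huR]
    exact InfInt.intAE_iff_ae (nullMeasurableSet_eq_fun hmeas hm.1).compl
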